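/- Consider \(\mathbb Z\) with generating set \(\{1,-1\}\). The Schreier graph of a \(\mathbb Z\)-set \(V\) has vertex set \(V\) and an edge labeled \(s\) from \(v\) to \(s\cdot v\) for every \(v\in V\), \(s\in\{1,-1\}\). For a set \(Q\), a map \(\varphi:V\to Q\) and \(r\ge 1\), let \(\mathrm{Conf}_r(\varphi)\) be the set of isomorphism classes of the rooted, edge-labeled, \(Q\)-vertex-labeled balls of radius \(r\) (induced subgraphs) that occur in \((V,\varphi)\), and let \(U^{r,Q}\) be the set of all classes that occur in some \(Q\)-labeled Schreier graph \(\mathbb Z/H\), \(H\le\mathbb Z\). A sequence \((S_k)\) of Schreier graphs of countable \(\mathbb Z\)-sets is qualitatively convergent if for every finite \(Q\), \(r\ge1\) and \(\mathcal A\subseteq U^{r,Q}\), either for all large \(k\) there is \(\varphi_k:V(S_k)\to Q\) with \(\mathrm{Conf}_r(\varphi_k)=\mathcal A\), or for all large \(k\) there is none. A continuous action \(\alpha\) of \(\mathbb Z\) on a compact totally disconnected metric space \(X\) is stable if, whenever \(\alpha(m)\) fixes \(x\), it fixes a neighbourhood of \(x\) pointwise. A stable action \(\alpha\) is a qualitative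 limit of a qualitatively convergent sequence \((S_k)\) if for every finite \(Q\), \(r\ge 1\) and \(\mathcal A\subseteq U^{r,Q}\): there is a continuous \(\psi:X\to Q\) with \(\mathrm{Conf}_r(\psi)=\mathcal A\) (with respect to \(\alpha\)) if and only if for all large \(k\) there is \(\varphi_k:V(S_k)\to Q\) with \(\mathrm{Conf}_r(\varphi_k)=\mathcal A\). The periodic spectrum \(PS(\alpha)\) is the set of integers \(n\ge 1\) for which there is a clopen \(U\subseteq X\) such that \(U,\alpha(1)U,\dots,\alpha(n-1)U\) partition \(X\). **Theorem.** Let \(W\) be a set of positive integers containing all positive divisors of each of its elements, and let \(n_1<n_2<\cdots\) be positive integers such that the sequence of cyclic Schreier graphs \(C_{n_k}\) (the Schreier graphs of \(\mathbb Z/n_k\mathbb Z\)) is qualitatively convergent and \(W\) is the arithmetic spectrum of \((n_k)\), i.e. the set of all \(m\ge1\) that divide all but finitely many \(n_k\). Then there exists a free minimal continuous action of \(\mathbb Z\) on the Cantor set with periodic spectrum \(W\), and every such action (in particular Shimomura's action \(\alpha_W\)) is a qualitative limit of \((C_{n_k})\). -/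

import Mathlib

open Topology

namespace QualLimit

/-- The symmetric generating set `{1, -1}` of `ℤ`; its elements are the edge labels. -/
abbrev Gen : Type := {s : ℤ // s = 1 ∨ s = -1}

/-- The Cantor set. -/
abbrev Cantor : Type := ℕ → Bool

/-! ### Rooted labeled balls and configurations -/

/-- A rooted directed graph with edges labeled by the generators and vertices labeled by `Q`. -/
structure RootedLabeled (Q : Type) where
  Vert : Type
  root : Vert
  edge : Gen → Vert → Vert → Prop
  label : Vert → Q

/-- Isomorphism preserving the root, the labeled edges and the vertex labels. -/
def RootedLabeled.Iso {Q : Type} (A B : RootedLabeled Q) : Prop :=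
  ∃ e : A.Vert ≃ B.Vert, e A.root = B.root ∧
    (∀ s a b, A.edge s a b ↔ B.edge s (e a) (e b)) ∧
    ∀ a, B.label (e a) = A.label a

instance RootedLabeled.setoid (Q : Type) : Setoid (RootedLabeled Q) where
  r := RootedLabeled.Iso
  iseqv :=
    { refl := fun A => ⟨Equiv.refl _, rfl, fun _ _ _ => Iff.rfl, fun _ => rfl⟩
      symm := by
        rintro A B ⟨e, h0, h1, h2⟩
        refine ⟨e.symm, by simp [← h0], fun s a b => by simp [h1], fun a => ?_⟩
        rw [← h2, e.apply_symm_apply]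
      trans := by
        rintro A B C ⟨e, h0, h1, h2⟩ ⟨f, k0, k1, k2⟩
        exact ⟨e.trans f, by simp [h0, k0], fun s a b => by simp [h1, k1],
          fun a => by simp [h2, k2]⟩ }

/-- Isomorphism classes of rooted, edge labeled, `Q`-vertex labeled graphs. -/
abbrev LabeledClass (Q : Type) : Type 1 := Quotient (RootedLabeled.setoid Q)

section Balls

variable {V : Type} [AddAction ℤ V]

/-- The vertices at distance at most `r` from `x` in the Schreier graph of the `ℤ`-set `V`: there
is an `s`-labeled edge from `y` to `s +ᵥ y` for every vertex `y` and every generator `s`. -/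
def ballSet : ℕ → V → Set V
  | 0, x => {x}
  | r + 1, x => {z | z ∈ ballSet r x ∨ ∃ y ∈ ballSet r x, ∃ s : Gen, (s : ℤ) +ᵥ y = z}

theorem mem_ballSet_self (r : ℕ) (x : V) : x ∈ ballSet r x := by
  induction r with
  | zero => exact rfl
  | succ r ih => exact Or.inl ih

/-- The rooted labeled ball of radius `r` around `x`, as an induced subgraph. -/
def ballAt {Q : Type} (r : ℕ) (φ : V → Q) (x : V) : RootedLabeled Q where
  Vert := ballSet r x
  root := ⟨x, mem_ballSet_self r x⟩
  edge := fun s a b => (s : ℤ) +ᵥ (a : V) = b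
  label := fun a => φ a

/-- `Conf_r(φ)`: the isomorphism classes of the labeled `r`-balls that occur in `(V, φ)`. -/
def Conf {Q : Type} (r : ℕ) (φ : V → Q) : Set (LabeledClass Q) :=
  {c | ∃ x : V, c = Quotient.mk _ (ballAt r φ x)}

end Balls

/-- The set `U^{r,Q}` of classes of labeled `r`-balls that occur in some `Q`-labeled Schreier
graph `S(ℤ, H)` on the coset space `ℤ ⧸ H`. -/
def ballClasses (r : ℕ) (Q : Type) : Set (LabeledClass Q) :=
  {c | ∃ (H : AddSubgroup ℤ) (φ : ℤ ⧸ H → Q), c ∈ Conf r φ}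

/-! ### Generalized Schreier graphs and qualitative convergence -/

/-- A generalized Schreier graph of `ℤ`: the graph of an action of `ℤ` on a countable set. -/
structure GenSchreierGraph where
  Vert : Type
  [countable : Countable Vert]
  [action : AddAction ℤ Vert]

attribute [instance] GenSchreierGraph.countable GenSchreierGraph.action

/-- The cyclic Schreier graph `C_n` on `ℤ / nℤ` (meant for `n ≥ 1`), with a `1`-labeled edge from
`a` to `a + 1` and a `-1`-labeled edge from `a` to `a - 1`. -/
def cyclicGraph (n : ℕ) : GenSchreierGraph :=
  { Vert := ZMod n
    countable := by
      cases n with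
      | zero => exact inferInstanceAs (Countable ℤ)
      | succ n => exact inferInstanceAs (Countable (Fin (n + 1)))
    action := AddAction.compHom (ZMod n) (Int.castAddHom (ZMod n)) }

/-- Qualitative convergence of a sequence of generalized Schreier graphs. -/
def QualitativelyConvergent (S : ℕ → GenSchreierGraph) : Prop :=
  ∀ (Q : Type) [Finite Q] (r : ℕ), 1 ≤ r → ∀ A : Set (LabeledClass Q), A ⊆ ballClasses r Q →
    ∃ N : ℕ,
      (∀ n ≥ N, ∃ φ : (S n).Vert → Q, Conf r φ = A) ∨
      (∀ n ≥ N, ¬ ∃ φ : (S n).Vert → Q, Conf r φ = A)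

/-! ### Actions of `ℤ` -/

/-- The action of `ℤ` on `X` is free. -/
def IsFreeAction (X : Type) [AddAction ℤ X] : Prop :=
  ∀ (m : ℤ) (x : X), m +ᵥ x = x → m = 0

/-- The action of `ℤ` on `X` is stable: whatever fixes a point fixes a neighbourhood of it. -/
def IsStableAction (X : Type) [TopologicalSpace X] [AddAction ℤ X] : Prop :=
  ∀ (m : ℤ) (x : X), m +ᵥ x = x → ∀ᶠ y in 𝓝 x, m +ᵥ y = y

/-- The qualitatively convergent sequence `S` converges qualitatively to the stable action of `ℤ`
on `X`. -/
def IsQualitativeLimit (S : ℕ → GenSchreierGraph) (X : Type) [TopologicalSpace X]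
    [AddAction ℤ X] : Prop :=
  QualitativelyConvergent S ∧ IsStableAction X ∧
  ∀ (Q : Type) [Finite Q] [TopologicalSpace Q] [DiscreteTopology Q] (r : ℕ), 1 ≤ r →
    ∀ A : Set (LabeledClass Q), A ⊆ ballClasses r Q →
      ((∃ ψ : X → Q, Continuous ψ ∧ Conf r ψ = A) ↔
        ∃ N : ℕ, ∀ n ≥ N, ∃ φ : (S n).Vert → Q, Conf r φ = A)

/-- The periodic spectrum: all `n ≥ 1` for which some clopen `U` has translates
`U, 1 +ᵥ U, …, (n - 1) +ᵥ U` that partition `X`. -/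
def periodicSpectrum (X : Type) [TopologicalSpace X] [AddAction ℤ X] : Set ℕ :=
  {n | 0 < n ∧ ∃ U : Set X, IsClopen U ∧
    (⋃ i : Fin n, (fun x : X => ((i : ℕ) : ℤ) +ᵥ x) '' U) = Set.univ ∧
    Pairwise fun i j : Fin n =>
      Disjoint ((fun x : X => ((i : ℕ) : ℤ) +ᵥ x) '' U) ((fun x : X => ((j : ℕ) : ℤ) +ᵥ x) '' U)}

/-! ### Arithmetic of the sequence -/

/-- A set of positive integers that contains every divisor of each of its elements. -/
def DivisionClosed (W : Set ℕ) : Prop :=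
  (∀ n ∈ W, 0 < n) ∧ ∀ n ∈ W, ∀ m : ℕ, m ∣ n → m ∈ W

/-- The arithmetic spectrum: the `m ≥ 1` that divide all but finitely many terms. -/
def arithmeticSpectrum (ρ : ℕ → ℕ) : Set ℕ :=
  {m | 0 < m ∧ ∀ᶠ k in Filter.atTop, m ∣ ρ k}

end QualLimit

/-!
The `r`-balls of a labeling of a free action, or of a long cycle, are words of length `2 * r + 1`,
and `Conf_r = 𝒜` says that the windows seen along the orbits run through exactly the vertices of
`𝒜` in the graph of overlaps of such words. Let `p` be the gcd of the lengths of the closed walks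
that visit all of `𝒜`. These lengths form an additive semigroup, so they include all large
multiples of `p`. Hence `C_n` with `n` large carries such a walk iff `p ∣ n`. A free minimal action
carries one iff `p` lies in its periodic spectrum: return times to a letter of a continuous walk are
multiples of `p`, and conversely walks can be written along the Kakutani–Rokhlin tower over a clopen
set whose return times are large multiples of `p`. So both sides of the limit condition only depend
on whether `p` is in the spectrum.

An action with periodic spectrum `W` is the orbit closure of a sequence that codes an irrational
rotation together with the residues modulo all elements of `W`. The irrational rotation makes it
free and adds nothing to the periodic spectrum. As a perfect, zero-dimensional, compact and second
countable space, the orbit closure is a Cantor set.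
-/

open Set

namespace QualLimit

/-! ### Brouwer's characterization of the Cantor set -/

section Cantor

variable {X : Type*} [TopologicalSpace X]

/-- Given a choice `D n C` of a set splitting `C` at stage `n`, the cells obtained from the whole
space by splitting repeatedly; a list records the choices made, the last one first. -/
def cell (D : ℕ → Set X → Set X) : List Bool → Set X
  | [] => univ
  | true :: l => cell D l ∩ D l.length (cell D l)
  | false :: l => cell D l \ D l.length (cell D l)

/-- A binary tree of nonempty clopen sets in which the two children of a set partition it and no
branch passes through two points; its branches are the points of the Cantor set. -/
structure IsBinaryPartitionTree (A : List Bool → Set X) : Prop where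
  nil : A [] = univ
  isClopen : ∀ l, IsClopen (A l)
  nonempty : ∀ l, (A l).Nonempty
  union : ∀ l, A (true :: l) ∪ A (false :: l) = A l
  disjoint : CantorScheme.Disjoint A
  eq_of_mem_branch : ∀ {x y : X} (b : ℕ → Bool),
    (∀ n, x ∈ A (PiNat.res b n)) → (∀ n, y ∈ A (PiNat.res b n)) → x = y

namespace IsBinaryPartitionTree

variable {A : List Bool → Set X}

theorem antitone (hA : IsBinaryPartitionTree A) : CantorScheme.Antitone A := by
  rintro l (_ | _)
  exacts [hA.union l ▸ subset_union_right, hA.union l ▸ subset_union_left]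

theorem exists_address (hA : IsBinaryPartitionTree A) (x : X) :
    ∃ b : ℕ → Bool, ∀ n, x ∈ A (PiNat.res b n) := by
  have hchild : ∀ l, ∃ a, x ∈ A l → x ∈ A (a :: l) := fun l => by
    by_cases hx : x ∈ A l
    · rcases (hA.union l).symm ▸ hx with h | h
      exacts [⟨true, fun _ => h⟩, ⟨false, fun _ => h⟩]
    · exact ⟨true, fun h => absurd h hx⟩
  choose a ha using hchild
  let path : ℕ → List Bool := fun n => Nat.rec [] (fun _ l => a l :: l) n
  have hres : ∀ n, PiNat.res (fun k => a (path k)) n = path n := fun n => by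
    induction n with
    | zero => rfl
    | succ n ih => rw [PiNat.res_succ, ih]
  refine ⟨fun k => a (path k), fun n => ?_⟩
  rw [hres]
  induction n with
  | zero => exact hA.nil ▸ mem_univ x
  | succ n ih => exact ha _ ih

theorem res_eq_of_mem (hA : IsBinaryPartitionTree A) {x : X} {b b' : ℕ → Bool} :
    ∀ {n : ℕ}, x ∈ A (PiNat.res b n) → x ∈ A (PiNat.res b' n) → PiNat.res b n = PiNat.res b' n
  | 0, _, _ => rfl
  | n + 1, h, h' => by
    have ih := hA.res_eq_of_mem (hA.antitone _ _ h) (hA.antitone _ _ h')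
    rw [PiNat.res_succ, PiNat.res_succ] at *
    rw [ih] at h ⊢
    by_contra hne
    exact (hA.disjoint _ fun hb => hne (by rw [hb])).notMem_of_mem_left h h'

theorem nonempty_homeomorph [CompactSpace X] (hA : IsBinaryPartitionTree A) :
    Nonempty (X ≃ₜ Cantor) := by
  choose address mem_address using hA.exists_address
  have address_eq : ∀ {x b n}, x ∈ A (PiNat.res b n) → ∀ k < n, address x k = b k :=
    fun h k hk => PiNat.res_eq_res.1 (hA.res_eq_of_mem (mem_address _ _) h) hk
  have hcont : Continuous address := by
    refine continuous_pi fun k => continuous_iff_continuousAt.2 fun x => ?_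
    refine ContinuousAt.congr continuousAt_const (f := fun _ => address x k) ?_
    filter_upwards [(hA.isClopen _).isOpen.mem_nhds (mem_address x (k + 1))] with y hy
    exact (address_eq hy k k.lt_succ_self).symm
  have hinj : Function.Injective address := fun x y h =>
    hA.eq_of_mem_branch (address x) (mem_address x) (h ▸ mem_address y)
  have hsurj : Function.Surjective address := fun b => by
    obtain ⟨x, hx⟩ := IsCompact.nonempty_iInter_of_sequence_nonempty_isCompact_isClosed
      (fun n => A (PiNat.res b n)) (fun n => hA.antitone _ _) (fun n => hA.nonempty _)
      (hA.isClopen _).isClosed.isCompact fun n => (hA.isClopen _).isClosed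
    exact ⟨x, funext fun k => address_eq (mem_iInter.1 hx (k + 1)) k k.lt_succ_self⟩
  exact ⟨hcont.homeoOfEquivCompactToT2 (f := Equiv.ofBijective address ⟨hinj, hsurj⟩)⟩

end IsBinaryPartitionTree

theorem exists_isClopen_split [CompactSpace X] [T2Space X] [TotallyDisconnectedSpace X]
    [PerfectSpace X] {C U : Set X} (hC : IsClopen C) (hne : C.Nonempty) (hU : IsClopen U) :
    ∃ D, IsClopen D ∧ (C ∩ D).Nonempty ∧ (C \ D).Nonempty ∧
      ∀ x ∈ C, ∀ y ∈ C, (x ∈ D ↔ y ∈ D) → (x ∈ U ↔ y ∈ U) := by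
  by_cases hcut : (C ∩ U).Nonempty ∧ (C \ U).Nonempty
  · exact ⟨U, hU, hcut.1, hcut.2, fun _ _ _ _ => id⟩
  have hU' : ∀ x ∈ C, ∀ y ∈ C, x ∈ U → y ∈ U := fun x hx y hy hxU => by
    by_contra hyU
    exact hcut ⟨⟨x, hx, hxU⟩, y, hy, hyU⟩
  obtain ⟨x, hx⟩ := hne
  obtain ⟨y, hy, hyx⟩ :=
    (infinite_of_mem_nhds x (hC.isOpen.mem_nhds hx)).nontrivial.exists_ne x
  obtain ⟨D, hD, hxD, hDy⟩ := compact_exists_isClopen_in_isOpen isOpen_compl_singleton hyx.symm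
  exact ⟨D, hD, ⟨x, hx, hxD⟩, ⟨y, hy, fun h => hDy h rfl⟩,
    fun a ha b hb _ => ⟨hU' a ha b hb, hU' b hb a ha⟩⟩

theorem exists_isBinaryPartitionTree (X : Type*) [TopologicalSpace X] [CompactSpace X] [T2Space X]
    [TotallyDisconnectedSpace X] [SecondCountableTopology X] [PerfectSpace X] [Nonempty X] :
    ∃ A : List Bool → Set X, IsBinaryPartitionTree A := by
  have : Countable (TopologicalSpace.Clopens X) :=
    TopologicalSpace.Clopens.countable_iff_secondCountable.2 inferInstance
  obtain ⟨U, hU⟩ := exists_surjective_nat (TopologicalSpace.Clopens X)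
  have hsplit : ∀ (n : ℕ) (C : Set X), ∃ D, IsClopen C → C.Nonempty →
      IsClopen D ∧ (C ∩ D).Nonempty ∧ (C \ D).Nonempty ∧
        ∀ x ∈ C, ∀ y ∈ C, (x ∈ D ↔ y ∈ D) → (x ∈ U n ↔ y ∈ U n) := fun n C => by
    by_cases h : IsClopen C ∧ C.Nonempty
    · exact (exists_isClopen_split h.1 h.2 (U n).isClopen).imp fun D hD _ _ => hD
    · exact ⟨∅, fun h₁ h₂ => absurd ⟨h₁, h₂⟩ h⟩
  choose D hD using hsplit
  have hcell : ∀ l, IsClopen (cell D l) ∧ (cell D l).Nonempty := fun l => by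
    induction l with
    | nil => exact ⟨isClopen_univ, univ_nonempty⟩
    | cons a l ih =>
      obtain ⟨hclopen, hin, hout, -⟩ := hD l.length _ ih.1 ih.2
      cases a
      exacts [⟨ih.1.diff hclopen, hout⟩, ⟨ih.1.inter hclopen, hin⟩]
  refine ⟨cell D, rfl, fun l => (hcell l).1, fun l => (hcell l).2,
    fun l => inter_union_sdiff _ _, ?_, fun {x y} b hx hy => ?_⟩
  · rintro l (_ | _) (_ | _) hne
    exacts [absurd rfl hne, disjoint_sdiff_inter, disjoint_sdiff_inter.symm, absurd rfl hne]
  by_contra hxy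
  obtain ⟨V, hV, hxV, hyV⟩ := exists_isClopen_of_totally_separated hxy
  obtain ⟨n, hn⟩ := hU ⟨V, hV⟩
  obtain ⟨-, -, -, hdecides⟩ := hD n _ (hcell (PiNat.res b n)).1 (hcell _).2
  have hx' := hx (n + 1)
  have hy' := hy (n + 1)
  have hsame : x ∈ D n (cell D (PiNat.res b n)) ↔ y ∈ D n (cell D (PiNat.res b n)) := by
    rw [PiNat.res_succ] at hx' hy'
    cases hb : b n <;> simp only [hb, cell, PiNat.res_length] at hx' hy'
    exacts [iff_of_false hx'.2 hy'.2, iff_of_true hx'.2 hy'.2]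
  rw [hn] at hdecides
  exact hyV ((hdecides x (hx n) y (hy n) hsame).1 hxV)

theorem nonempty_homeomorph_cantor (X : Type*) [TopologicalSpace X] [CompactSpace X] [T2Space X]
    [TotallyDisconnectedSpace X] [SecondCountableTopology X] [PerfectSpace X] [Nonempty X] :
    Nonempty (X ≃ₜ Cantor) :=
  let ⟨_, hA⟩ := exists_isBinaryPartitionTree X
  hA.nonempty_homeomorph

end Cantor

/-! ### The periodic spectrum -/

section PeriodicSpectrum

theorem map_vadd_of_map_one_vadd {X R : Type*} [AddAction ℤ X] [AddGroupWithOne R] {f : X → R}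
    (hf : ∀ x, f ((1 : ℤ) +ᵥ x) = f x + 1) (m : ℤ) (x : X) : f (m +ᵥ x) = f x + m := by
  induction m with
  | zero => rw [zero_vadd, Int.cast_zero, add_zero]
  | succ k ih => rw [Int.cast_add, Int.cast_one, ← add_assoc, ← ih, ← hf, vadd_vadd, add_comm]
  | pred k ih =>
    have hstep := hf ((-(k : ℤ) - 1) +ᵥ x)
    rw [vadd_vadd, add_sub_cancel, ih] at hstep
    rw [← add_right_cancel_iff (a := (1 : R)), ← hstep, add_assoc]
    push_cast
    rw [sub_add_cancel]

variable {X : Type} [TopologicalSpace X] [AddAction ℤ X] {n : ℕ}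

theorem mem_periodicSpectrum_iff_existsUnique :
    n ∈ periodicSpectrum X ↔
      0 < n ∧ ∃ U : Set X, IsClopen U ∧ ∀ x, ∃! i : Fin n, -((i : ℕ) : ℤ) +ᵥ x ∈ U := by
  refine and_congr_right fun _ => exists_congr fun U => and_congr_right fun _ => ?_
  simp only [image_vadd, eq_univ_iff_forall, mem_iUnion, Pairwise, Set.disjoint_left,
    mem_vadd_set_iff_neg_vadd_mem, ExistsUnique]
  constructor
  · rintro ⟨hcover, hdisj⟩ x
    obtain ⟨i, hi⟩ := hcover x
    exact ⟨i, hi, fun j hj => by_contra fun hne => hdisj hne hj hi⟩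
  · refine fun h => ⟨fun x => (h x).imp fun _ => And.left, fun i j hne x hi hj => hne ?_⟩
    obtain ⟨k, -, hk⟩ := h x
    exact (hk i hi).trans (hk j hj).symm

theorem exists_continuous_map_one_vadd_of_mem_periodicSpectrum [ContinuousConstVAdd ℤ X]
    (hn : n ∈ periodicSpectrum X) :
    ∃ f : X → ZMod n, Continuous f ∧ ∀ x, f ((1 : ℤ) +ᵥ x) = f x + 1 := by
  obtain ⟨-, U, hU, hunique⟩ := mem_periodicSpectrum_iff_existsUnique.1 hn
  choose index mem_index using fun x => (hunique x).exists
  have eq_index : ∀ x (i : Fin n), -((i : ℕ) : ℤ) +ᵥ x ∈ U → i = index x :=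
    fun x i hi => (hunique x).unique hi (mem_index x)
  have hcont : Continuous index := continuous_discrete_rng.2 fun i => by
    have : index ⁻¹' {i} = (fun x => -((i : ℕ) : ℤ) +ᵥ x) ⁻¹' U := by
      ext x
      exact ⟨fun h => h ▸ mem_index x, fun h => (eq_index x i h).symm⟩
    exact this ▸ hU.isOpen.preimage (continuous_const_vadd _)
  have hprev (k : ℕ) (x : X) : -((k + 1 : ℕ) : ℤ) +ᵥ (1 : ℤ) +ᵥ x = -(k : ℤ) +ᵥ x := by
    rw [vadd_vadd, Nat.cast_add_one, neg_add, neg_add_cancel_right]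
  refine ⟨fun x => ((index x : ℕ) : ZMod n),
    (continuous_of_discreteTopology (f := fun i : Fin n => ((i : ℕ) : ZMod n))).comp hcont,
    fun x => ?_⟩
  dsimp only
  rcases lt_or_ge ((index x : ℕ) + 1) n with hlt | hge
  · rw [← eq_index ((1 : ℤ) +ᵥ x) ⟨index x + 1, hlt⟩ (by rw [hprev]; exact mem_index x),
      Nat.cast_add_one]
  have hzero : (index ((1 : ℤ) +ᵥ x) : ℕ) = 0 := by
    have hmem := mem_index ((1 : ℤ) +ᵥ x)
    rcases hk : (index ((1 : ℤ) +ᵥ x) : ℕ) with _ | k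
    · rfl
    rw [hk, hprev] at hmem
    have := congrArg Fin.val (eq_index x ⟨k, by omega⟩ hmem)
    dsimp only at this
    omega
  have hlast : (index x : ℕ) + 1 = n := by omega
  rw [hzero, ← Nat.cast_add_one, hlast, Nat.cast_zero, ZMod.natCast_self]

theorem mem_periodicSpectrum_iff [ContinuousConstVAdd ℤ X] :
    n ∈ periodicSpectrum X ↔
      0 < n ∧ ∃ f : X → ZMod n, Continuous f ∧ ∀ x, f ((1 : ℤ) +ᵥ x) = f x + 1 := by
  refine ⟨fun h => ⟨h.1, exists_continuous_map_one_vadd_of_mem_periodicSpectrum h⟩, ?_⟩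
  rintro ⟨hn, f, hf, hstep⟩
  have : NeZero n := ⟨hn.ne'⟩
  refine mem_periodicSpectrum_iff_existsUnique.2
    ⟨hn, f ⁻¹' {0}, (isClopen_discrete _).preimage hf, fun x => ?_⟩
  simp only [mem_preimage, map_vadd_of_map_one_vadd hstep, mem_singleton_iff, Int.cast_neg,
    Int.cast_natCast, add_neg_eq_zero]
  refine ⟨⟨(f x).val, (f x).val_lt⟩, (ZMod.natCast_zmod_val _).symm, fun i hi => ?_⟩
  ext
  exact ((congrArg ZMod.val hi).trans (ZMod.val_natCast_of_lt i.isLt)).symm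

end PeriodicSpectrum

/-! ### Balls as windows -/

section Windows

variable {r : ℕ} {Q : Type}

/-- Labelings of the integer interval `[-r, r]`: the `r`-balls in orbits without short periods. -/
abbrev Window (r : ℕ) (Q : Type) : Type := Icc (-(r : ℤ)) r → Q

/-- The labeled path on `[-r, r]` given by a window, rooted at `0`. -/
def windowGraph (u : Window r Q) : RootedLabeled Q where
  Vert := Icc (-(r : ℤ)) r
  root := ⟨0, by simp⟩
  edge s a b := (s : ℤ) + a = b
  label := u

/-- The isomorphism class of a window, viewed as a labeled ball. -/
def windowClass (u : Window r Q) : LabeledClass Q := Quotient.mk _ (windowGraph u)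

/-- `v` agrees with the shift of `u` by one where both are defined, so `v` can be the window seen
from `1 +ᵥ x` when `u` is the one seen from `x`. -/
def Follows (u v : Window r Q) : Prop :=
  ∀ i j : Icc (-(r : ℤ)) r, (j : ℤ) = i + 1 → v i = u j

theorem eq_self_of_map_gen_add {e : Icc (-(r : ℤ)) r → Icc (-(r : ℤ)) r}
    (hzero : e ⟨0, by simp⟩ = ⟨0, by simp⟩)
    (hadd : ∀ (s : Gen) (a b : Icc (-(r : ℤ)) r), (s : ℤ) + a = b → (s : ℤ) + e a = e b)
    (i : Icc (-(r : ℤ)) r) : e i = i := by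
  have hmul : ∀ (s : Gen) (k : ℕ) (a : Icc (-(r : ℤ)) r), (a : ℤ) = k * s → e a = a := by
    intro s k
    induction k with
    | zero =>
      intro a ha
      obtain rfl : a = ⟨0, by simp⟩ := Subtype.ext (by simpa using ha)
      exact hzero
    | succ k ih =>
      rintro ⟨a, ha⟩ rfl
      have hprev : (k * s : ℤ) ∈ Icc (-(r : ℤ)) r := by
        obtain ⟨s, rfl | rfl⟩ := s <;> push_cast [mem_Icc] at ha ⊢ <;> omega
      have hstep := hadd s ⟨k * s, hprev⟩ ⟨_, ha⟩ (by push_cast; ring)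
      rw [ih _ rfl] at hstep
      exact Subtype.ext (by rw [← hstep]; push_cast; ring)
  obtain ⟨k, hk | hk⟩ := (i : ℤ).eq_nat_or_neg
  · exact hmul ⟨1, Or.inl rfl⟩ k i (by rw [hk, mul_one])
  · exact hmul ⟨-1, Or.inr rfl⟩ k i (by rw [hk, mul_neg_one])

theorem windowClass_injective (r : ℕ) (Q : Type) :
    Function.Injective (windowClass : Window r Q → LabeledClass Q) := fun u v huv => by
  obtain ⟨(e : Icc (-(r : ℤ)) r ≃ Icc (-(r : ℤ)) r), hroot, hedge, hlabel⟩ := Quotient.exact huv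
  funext i
  have hi : v (e i) = u i := hlabel i
  exact hi.symm.trans (congrArg v (eq_self_of_map_gen_add hroot (fun s a b => (hedge s a b).1) i))

variable {V : Type} [AddAction ℤ V]

theorem ballSet_eq_image (r : ℕ) (x : V) : ballSet r x = (· +ᵥ x) '' Icc (-(r : ℤ)) r := by
  induction r with
  | zero => simp [ballSet]
  | succ r ih =>
    ext z
    simp only [ballSet, ih, mem_ofPred_eq, mem_image, exists_exists_and_eq_and, vadd_vadd, mem_Icc,
      Nat.cast_add_one]
    constructor
    · rintro (⟨i, hi, rfl⟩ | ⟨i, hi, ⟨s, rfl | rfl⟩, rfl⟩)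
      exacts [⟨i, by omega, rfl⟩, ⟨1 + i, by omega, rfl⟩, ⟨-1 + i, by omega, rfl⟩]
    · rintro ⟨i, hi, rfl⟩
      obtain hlast | hlast | hi' : i = r + 1 ∨ i = -(r + 1) ∨ -(r : ℤ) ≤ i ∧ i ≤ r := by omega
      · exact Or.inr ⟨r, by omega, ⟨1, Or.inl rfl⟩, by rw [hlast, add_comm]⟩
      · exact Or.inr ⟨-r, by omega, ⟨-1, Or.inr rfl⟩, by rw [hlast, neg_add_rev]⟩
      · exact Or.inl ⟨i, hi', rfl⟩

/-- The action of `ℤ` on `V` is free as far as integers of absolute value at most `N` are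
concerned: no orbit has a nonzero period of this size. -/
def IsFreeUpTo (N : ℕ) (V : Type*) [AddAction ℤ V] : Prop :=
  ∀ (x : V) (m : ℤ), |m| ≤ N → m +ᵥ x = x → m = 0

theorem IsFreeUpTo.eq_of_vadd_eq {N : ℕ} (hV : IsFreeUpTo N V) {x : V} {m n : ℤ}
    (hmn : |m - n| ≤ N) (h : m +ᵥ x = n +ᵥ x) : m = n :=
  sub_eq_zero.1 <| hV x _ hmn <| by rw [sub_eq_neg_add, add_vadd, h, neg_vadd_vadd]

/-- The window of radius `r` that the labeling `φ` shows around `x`. -/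
def windowAt (r : ℕ) (φ : V → Q) (x : V) : Window r Q := fun i => φ ((i : ℤ) +ᵥ x)

theorem mk_ballAt_eq_windowClass (hV : IsFreeUpTo (2 * r + 1) V) (φ : V → Q) (x : V) :
    (Quotient.mk _ (ballAt r φ x) : LabeledClass Q) = windowClass (windowAt r φ x) := by
  let e : Icc (-(r : ℤ)) r → ballSet r x := fun i =>
    ⟨(i : ℤ) +ᵥ x, ballSet_eq_image r x ▸ mem_image_of_mem _ i.2⟩
  have he : Function.Bijective e := by
    refine ⟨fun ⟨i, hi⟩ ⟨j, hj⟩ hij => Subtype.ext ?_, fun ⟨z, hz⟩ => ?_⟩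
    · refine hV.eq_of_vadd_eq ?_ (Subtype.ext_iff.1 hij)
      rw [mem_Icc] at hi hj
      rw [abs_le]
      dsimp only
      omega
    · obtain ⟨i, hi, rfl⟩ := ballSet_eq_image r x ▸ hz
      exact ⟨⟨i, hi⟩, rfl⟩
  refine Eq.symm (Quotient.sound ?_)
  refine ⟨Equiv.ofBijective e he, Subtype.ext (zero_vadd _ _), ?_, fun _ => rfl⟩
  rintro s ⟨a, ha⟩ ⟨b, hb⟩
  change (s : ℤ) + a = b ↔ (s : ℤ) +ᵥ (a +ᵥ x) = b +ᵥ x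
  rw [vadd_vadd]
  refine ⟨fun h => by rw [h], hV.eq_of_vadd_eq ?_⟩
  rw [mem_Icc] at ha hb
  rw [abs_le]
  obtain ⟨s, rfl | rfl⟩ := s <;> dsimp only <;> omega

theorem conf_eq_image_windowClass (hV : IsFreeUpTo (2 * r + 1) V) (φ : V → Q) :
    Conf r φ = windowClass '' range (windowAt r φ) := by
  ext c
  simp only [Conf, mem_ofPred_eq, mk_ballAt_eq_windowClass hV, ← range_comp, mem_range, eq_comm,
    Function.comp_apply]

/-- An `R`-walk along the orbits: a labeling in which any two consecutive points carry
`R`-related labels. -/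
def IsWalk {V M : Type*} [AddAction ℤ V] (R : M → M → Prop) (g : V → M) : Prop :=
  ∀ x, R (g x) (g ((1 : ℤ) +ᵥ x))

theorem isWalk_windowAt (φ : V → Q) : IsWalk Follows (windowAt r φ) := fun x i j hij => by
  rw [windowAt, windowAt, vadd_vadd, hij]

theorem IsWalk.apply_natCast_vadd {g : V → Window r Q} (hg : IsWalk Follows g) (k : ℕ) (x : V)
    {i j : Icc (-(r : ℤ)) r} (hij : (j : ℤ) = i + k) : g ((k : ℤ) +ᵥ x) i = g x j := by
  induction k generalizing i with
  | zero =>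
    obtain rfl : j = i := Subtype.ext (by simpa using hij)
    rw [Nat.cast_zero, zero_vadd]
  | succ k ih =>
    push_cast at hij
    have hmem : (i : ℤ) + 1 ∈ Icc (-(r : ℤ)) r := by
      have hi := i.2.1
      have hj := j.2.2
      rw [mem_Icc]
      omega
    rw [Nat.cast_add_one, add_comm, add_vadd, hg _ i ⟨i + 1, hmem⟩ rfl]
    exact ih (by dsimp only; omega)

theorem IsWalk.windowAt_eq {g : V → Window r Q} (hg : IsWalk Follows g) :
    windowAt r (fun x => g x ⟨0, by simp⟩) = g := by
  funext x i
  obtain ⟨k, hk | hk⟩ := (i : ℤ).eq_nat_or_neg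
  · rw [windowAt, hk]
    exact hg.apply_natCast_vadd k x (by simpa using hk)
  · rw [windowAt, ← hg.apply_natCast_vadd k _ (show ((⟨0, _⟩ : Icc (-(r : ℤ)) r) : ℤ) = i + k by
      rw [hk, neg_add_cancel]), hk, vadd_neg_vadd]

theorem exists_continuous_conf_eq_iff [TopologicalSpace V] [ContinuousConstVAdd ℤ V]
    [TopologicalSpace Q] (hV : IsFreeUpTo (2 * r + 1) V) (A : Set (LabeledClass Q)) :
    (∃ φ : V → Q, Continuous φ ∧ Conf r φ = A) ↔
      A ⊆ range (windowClass : Window r Q → _) ∧ ∃ g : V → Window r Q, Continuous g ∧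
        range g = windowClass ⁻¹' A ∧ IsWalk Follows g := by
  constructor
  · rintro ⟨φ, hφ, rfl⟩
    rw [conf_eq_image_windowClass hV, preimage_image_eq _ (windowClass_injective r Q)]
    exact ⟨image_subset_range _ _, windowAt r φ,
      continuous_pi fun i => hφ.comp (continuous_const_vadd _), rfl, isWalk_windowAt φ⟩
  · rintro ⟨hA, g, hg, hgA, hwalk⟩
    refine ⟨fun x => g x ⟨0, by simp⟩, continuous_pi_iff.1 hg _, ?_⟩
    rw [conf_eq_image_windowClass hV, hwalk.windowAt_eq, hgA, image_preimage_eq_of_subset hA]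

theorem exists_conf_eq_iff (hV : IsFreeUpTo (2 * r + 1) V) (A : Set (LabeledClass Q)) :
    (∃ φ : V → Q, Conf r φ = A) ↔
      A ⊆ range (windowClass : Window r Q → _) ∧ ∃ g : V → Window r Q,
        range g = windowClass ⁻¹' A ∧ IsWalk Follows g := by
  let _ : TopologicalSpace V := ⊥
  let _ : TopologicalSpace Q := ⊥
  have : DiscreteTopology V := ⟨rfl⟩
  have : ContinuousConstVAdd ℤ V := ⟨fun _ => continuous_of_discreteTopology⟩
  simpa only [continuous_of_discreteTopology, true_and] using exists_continuous_conf_eq_iff hV A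

end Windows

/-! ### Closed covering walks -/

theorem eventually_mem_of_setGcd_dvd {L : Set ℕ} (hadd : ∀ m ∈ L, ∀ n ∈ L, m + n ∈ L) :
    ∀ᶠ n in Filter.atTop, Nat.setGcd L ∣ n → n ∈ L := by
  obtain ⟨N, hN⟩ := Nat.exists_mem_closure_of_ge L
  have hclosure : ∀ n ∈ AddSubmonoid.closure L, n = 0 ∨ n ∈ L := fun n hn => by
    induction hn using AddSubmonoid.closure_induction with
    | mem x hx => exact Or.inr hx
    | zero => exact Or.inl rfl
    | add x y _ _ hx hy =>
      rcases hx with rfl | hx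
      · rwa [zero_add]
      rcases hy with rfl | hy
      exacts [Or.inr hx, Or.inr (hadd x hx y hy)]
  filter_upwards [Filter.eventually_ge_atTop N, Filter.eventually_gt_atTop 0] with n hn hpos hdvd
  exact (hclosure n (hN n hn hdvd)).resolve_left hpos.ne'

theorem setGcd_mem_arithmeticSpectrum_iff {L : Set ℕ} (hadd : ∀ m ∈ L, ∀ n ∈ L, m + n ∈ L)
    {ρ : ℕ → ℕ} (hρ : Filter.Tendsto ρ Filter.atTop Filter.atTop) :
    Nat.setGcd L ∈ arithmeticSpectrum ρ ↔ ∀ᶠ k in Filter.atTop, ρ k ∈ L := by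
  refine ⟨fun h => ?_, fun h => ⟨?_, h.mono fun k => Nat.setGcd_dvd_of_mem⟩⟩
  · filter_upwards [h.2, hρ.eventually (eventually_mem_of_setGcd_dvd hadd)] with k hdvd hmem
    exact hmem hdvd
  · obtain ⟨k, hk, hpos⟩ := (h.and (hρ.eventually_gt_atTop 0)).exists
    exact Nat.pos_of_dvd_of_pos (Nat.setGcd_dvd_of_mem hk) hpos

section Walks

variable {M : Type*} {R : M → M → Prop} {S : Set M} {s : M} {n : ℕ}

/-- `c 0, …, c n` is a closed `R`-walk of length `n ≥ 1` based at `s` whose set of vertices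
is `S`. -/
structure IsCoveringWalk (R : M → M → Prop) (S : Set M) (s : M) (n : ℕ) (c : ℕ → M) : Prop where
  pos : 0 < n
  start_eq : c 0 = s
  end_eq : c n = s
  step : ∀ i < n, R (c i) (c (i + 1))
  image_eq : c '' Iio n = S

/-- The lengths of the closed `R`-walks based at `s` with vertex set `S`. -/
def coverLengths (R : M → M → Prop) (S : Set M) (s : M) : Set ℕ :=
  {n | ∃ c, IsCoveringWalk R S s n c}

theorem IsCoveringWalk.append {m : ℕ} {c d : ℕ → M} (hc : IsCoveringWalk R S s m c)
    (hd : IsCoveringWalk R S s n d) :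
    IsCoveringWalk R S s (m + n) fun i => if i < m then c i else d (i - m) where
  pos := Nat.add_pos_left hc.pos n
  start_eq := by rw [if_pos hc.pos, hc.start_eq]
  end_eq := by rw [if_neg (by omega), Nat.add_sub_cancel_left, hd.end_eq]
  step i hi := by
    rcases lt_trichotomy (i + 1) m with hlt | heq | hgt
    · rw [if_pos hlt, if_pos (by omega)]
      exact hc.step i (by omega)
    · rw [if_pos (by omega), if_neg heq.not_lt, heq, Nat.sub_self, hd.start_eq, ← hc.end_eq, ← heq]
      exact hc.step i (by omega)
    · rw [if_neg (by omega), if_neg (by omega), Nat.sub_add_comm (by omega)]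
      exact hd.step _ (by omega)
  image_eq := by
    refine Subset.antisymm ?_ ?_
    · rintro _ ⟨i, hi : i < m + n, rfl⟩
      dsimp only
      split_ifs with h
      · exact hc.image_eq ▸ mem_image_of_mem c h
      · exact hd.image_eq ▸ mem_image_of_mem d (show i - m < n by omega)
    · rw [← hc.image_eq]
      rintro _ ⟨i, hi : i < m, rfl⟩
      exact ⟨i, show i < m + n by omega, if_pos hi⟩

theorem add_mem_coverLengths {m : ℕ} (hm : m ∈ coverLengths R S s) (hn : n ∈ coverLengths R S s) :
    m + n ∈ coverLengths R S s :=
  let ⟨_, hc⟩ := hm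
  let ⟨_, hd⟩ := hn
  ⟨_, hc.append hd⟩

theorem IsWalk.mem_coverLengths {V : Type*} [AddAction ℤ V] {g : V → M} (hg : IsWalk R g) {x : V}
    (hn : 0 < n) (hreturn : g ((n : ℤ) +ᵥ x) = g x)
    (hcover : ∀ y, ∃ i < n, g ((i : ℤ) +ᵥ x) = g y) : n ∈ coverLengths R (range g) (g x) := by
  refine ⟨fun i => g ((i : ℤ) +ᵥ x), hn, by rw [Nat.cast_zero, zero_vadd], hreturn, fun i _ => ?_,
    Subset.antisymm ?_ (range_subset_iff.2 hcover)⟩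
  · rw [Nat.cast_add_one, add_comm, add_vadd]
    exact hg _
  · rintro _ ⟨i, -, rfl⟩
    exact mem_range_self _

theorem isFreeUpTo_cyclicGraph {N : ℕ} (hN : N < n) : IsFreeUpTo N (cyclicGraph n).Vert := by
  intro (a : ZMod n) m hm (hfix : (m : ZMod n) + a = a)
  rw [add_eq_right, ZMod.intCast_zmod_eq_zero_iff_dvd] at hfix
  exact Int.eq_zero_of_abs_lt_dvd hfix (by omega)

theorem isWalk_cyclicGraph_iff {g : ZMod n → M} :
    IsWalk (V := (cyclicGraph n).Vert) R g ↔ ∀ a : ZMod n, R (g a) (g (a + 1)) := by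
  refine forall_congr' fun (a : ZMod n) => ?_
  change R (g a) (g (((1 : ℤ) : ZMod n) + a)) ↔ _
  rw [Int.cast_one, add_comm]

theorem IsCoveringWalk.exists_walk_cyclicGraph {c : ℕ → M} (hc : IsCoveringWalk R S s n c) :
    ∃ g : (cyclicGraph n).Vert → M, range g = S ∧ IsWalk R g := by
  have : NeZero n := ⟨hc.pos.ne'⟩
  have hval : ∀ i ≤ n, c (ZMod.val (i : ZMod n)) = c i := fun i hi => by
    rcases hi.lt_or_eq with hlt | rfl
    · rw [ZMod.val_cast_of_lt hlt]
    · rw [ZMod.natCast_self, ZMod.val_zero, hc.start_eq, hc.end_eq]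
  refine ⟨fun a : ZMod n => c a.val, ?_, isWalk_cyclicGraph_iff.2 fun a => ?_⟩
  · rw [← hc.image_eq]
    refine Subset.antisymm (range_subset_iff.2 fun a => mem_image_of_mem c (ZMod.val_lt a)) ?_
    rintro _ ⟨i, hi : i < n, rfl⟩
    exact ⟨(i : ZMod n), hval i hi.le⟩
  · have hnext : a + 1 = ((a.val + 1 : ℕ) : ZMod n) := by
      rw [Nat.cast_add_one, ZMod.natCast_zmod_val]
    rw [hnext, hval _ a.val_lt]
    exact hc.step _ a.val_lt

theorem exists_walk_cyclicGraph_iff (hn : 0 < n) (hs : s ∈ S) :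
    (∃ g : (cyclicGraph n).Vert → M, range g = S ∧ IsWalk R g) ↔ n ∈ coverLengths R S s := by
  refine ⟨?_, fun ⟨_, hc⟩ => hc.exists_walk_cyclicGraph⟩
  rintro ⟨g, rfl, hg⟩
  obtain ⟨(x : ZMod n), rfl⟩ := hs
  have : NeZero n := ⟨hn.ne'⟩
  refine hg.mem_coverLengths hn (congrArg g ?_) fun (y : ZMod n) =>
    ⟨(y - x).val, ZMod.val_lt _, congrArg g ?_⟩
  · change ((n : ℤ) : ZMod n) + x = x
    rw [Int.cast_natCast, ZMod.natCast_self, zero_add]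
  · change (((y - x).val : ℤ) : ZMod n) + x = y
    rw [Int.cast_natCast, ZMod.natCast_zmod_val, sub_add_cancel]

end Walks

/-! ### Minimal actions of `ℤ` -/

section Returns

variable {X : Type*} [AddAction ℤ X]

/-- The times after which some point of `V` is back in `V`. -/
def returnTimes (V : Set X) : Set ℕ := {n | ∃ x ∈ V, (n : ℤ) +ᵥ x ∈ V}

/-- The time of the first return of `x` to `V`, or `0` if there is none. -/
noncomputable def nextReturn (V : Set X) (x : X) : ℕ := sInf {n | 0 < n ∧ (n : ℤ) +ᵥ x ∈ V}

/-- The time elapsed at `x` since the last visit to `V`, or `0` if there was none. -/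
noncomputable def lastVisit (V : Set X) (x : X) : ℕ := sInf {n | -(n : ℤ) +ᵥ x ∈ V}

theorem natCast_vadd_notMem_of_lt_nextReturn {V : Set X} {x : X} {i : ℕ} (hpos : 0 < i)
    (hi : i < nextReturn V x) : (i : ℤ) +ᵥ x ∉ V :=
  fun h => Nat.notMem_of_lt_sInf hi ⟨hpos, h⟩

theorem lastVisit_natCast_vadd {V : Set X} {b : X} (hb : b ∈ V) {i : ℕ}
    (hi : i < nextReturn V b) : lastVisit V ((i : ℤ) +ᵥ b) = i := by
  refine le_antisymm (Nat.sInf_le (by rwa [mem_ofPred_eq, neg_vadd_vadd])) ?_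
  refine le_csInf ⟨i, by rwa [mem_ofPred_eq, neg_vadd_vadd]⟩ fun j (hj : -(j : ℤ) +ᵥ _ ∈ V) => ?_
  by_contra! hlt
  refine natCast_vadd_notMem_of_lt_nextReturn (V := V) (x := b) (i := i - j) (by omega) (by omega)
    ?_
  rwa [vadd_vadd, neg_add_eq_sub, ← Nat.cast_sub hlt.le] at hj

variable [TopologicalSpace X] [ContinuousConstVAdd ℤ X]

theorem exists_isClopen_forall_returnTimes_ge [CompactSpace X] [T2Space X]
    [TotallyDisconnectedSpace X] {x : X} (hx : ∀ m : ℤ, m +ᵥ x = x → m = 0) {O : Set X}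
    (hO : O ∈ 𝓝 x) (N : ℕ) :
    ∃ V ⊆ O, IsClopen V ∧ x ∈ V ∧ ∀ n ∈ returnTimes V, 0 < n → N ≤ n := by
  have hsep : ∀ n ∈ Ioo 0 N, ∃ P ∈ 𝓝 x, ∀ y ∈ P, (n : ℤ) +ᵥ y ∉ P := fun n hn => by
    have hne : (n : ℤ) +ᵥ x ≠ x := fun h => hn.1.ne' (by exact_mod_cast hx n h)
    obtain ⟨P, P', hP, hP', hnx, hxP', hdisj⟩ := t2_separation hne
    refine ⟨P' ∩ ((n : ℤ) +ᵥ ·) ⁻¹' P, Filter.inter_mem (hP'.mem_nhds hxP')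
      ((hP.preimage (continuous_const_vadd _)).mem_nhds hnx), fun y hy hy' => ?_⟩
    exact hdisj.notMem_of_mem_left hy.2 hy'.1
  choose! P hP hPn using hsep
  obtain ⟨V, ⟨hxV, hV⟩, hVP⟩ := (nhds_basis_clopen x).mem_iff.1
    (Filter.inter_mem hO ((Filter.biInter_mem (finite_Ioo 0 N)).2 hP))
  refine ⟨V, hVP.trans inter_subset_left, hV, hxV, fun n ⟨y, hy, hny⟩ hpos => ?_⟩
  by_contra! hlt
  exact hPn n ⟨hpos, hlt⟩ y (mem_iInter₂.1 (hVP hy).2 n ⟨hpos, hlt⟩)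
    (mem_iInter₂.1 (hVP hny).2 n ⟨hpos, hlt⟩)

theorem isOpen_setOf_nextReturn_eq {V : Set X} (hV : IsClopen V) {n : ℕ} (hn : 0 < n) :
    IsOpen {x | nextReturn V x = n} := by
  have heq : {x | nextReturn V x = n} =
      ((n : ℤ) +ᵥ ·) ⁻¹' V ∩ ⋂ i ∈ Ioo 0 n, ((i : ℤ) +ᵥ ·) ⁻¹' Vᶜ := by
    ext x
    simp only [mem_ofPred_eq, mem_inter_iff, mem_preimage, mem_iInter, mem_compl_iff]
    constructor
    · rintro rfl
      exact ⟨(Nat.sInf_mem (Nat.nonempty_of_pos_sInf hn)).2,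
        fun i hi => natCast_vadd_notMem_of_lt_nextReturn hi.1 hi.2⟩
    · rintro ⟨hmem, hbefore⟩
      refine le_antisymm (Nat.sInf_le ⟨hn, hmem⟩) (le_csInf ⟨n, hn, hmem⟩ fun i hi => ?_)
      by_contra! hlt
      exact hbefore i ⟨hi.1, hlt⟩ hi.2
  rw [heq]
  exact (hV.isOpen.preimage (continuous_const_vadd _)).inter <|
    (finite_Ioo 0 n).isOpen_biInter fun i _ =>
      hV.compl.isOpen.preimage (continuous_const_vadd (i : ℤ))

variable [CompactSpace X] [AddAction.IsMinimal ℤ X] {U V : Set X}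

theorem exists_forall_exists_le_natCast_vadd_mem (hU : IsOpen U) (hne : U.Nonempty) :
    ∃ B : ℕ, ∀ x : X, ∃ k ≤ B, (k : ℤ) +ᵥ x ∈ U := by
  obtain ⟨I, hI⟩ := isCompact_univ.exists_finite_cover_vadd ℤ hU hne
  obtain ⟨B, hB⟩ := (I.image Int.natAbs).bddAbove
  refine ⟨2 * B, fun x => ?_⟩
  obtain ⟨k, hk, hxk⟩ := mem_iUnion₂.1 (hI (mem_univ ((B : ℤ) +ᵥ x)))
  have hkB : k.natAbs ≤ B := hB (Finset.mem_coe.2 (Finset.mem_image_of_mem _ hk))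
  rw [mem_vadd_set_iff_neg_vadd_mem, vadd_vadd] at hxk
  refine ⟨(-k + B).toNat, by omega, ?_⟩
  rwa [Int.toNat_of_nonneg (by omega)]

theorem exists_ge_natCast_vadd_mem (hU : IsOpen U) (hne : U.Nonempty) (N : ℕ) (x : X) :
    ∃ n ≥ N, (n : ℤ) +ᵥ x ∈ U := by
  obtain ⟨B, hB⟩ := exists_forall_exists_le_natCast_vadd_mem hU hne
  obtain ⟨k, -, hk⟩ := hB ((N : ℤ) +ᵥ x)
  exact ⟨k + N, Nat.le_add_left N k, by rwa [Nat.cast_add, add_vadd]⟩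

theorem exists_neg_natCast_vadd_mem (hU : IsOpen U) (hne : U.Nonempty) (x : X) :
    ∃ n : ℕ, -(n : ℤ) +ᵥ x ∈ U := by
  obtain ⟨B, hB⟩ := exists_forall_exists_le_natCast_vadd_mem hU hne
  obtain ⟨k, hkB, hk⟩ := hB (-(B : ℤ) +ᵥ x)
  refine ⟨B - k, ?_⟩
  rwa [Nat.cast_sub hkB, neg_sub, sub_eq_add_neg, add_vadd]

theorem nextReturn_mem (hV : IsOpen V) (hne : V.Nonempty) (x : X) :
    0 < nextReturn V x ∧ (nextReturn V x : ℤ) +ᵥ x ∈ V :=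
  Nat.sInf_mem (exists_ge_natCast_vadd_mem hV hne 1 x)

theorem exists_eq_natCast_vadd (hV : IsOpen V) (hne : V.Nonempty) (y : X) :
    ∃ b ∈ V, ∃ i < nextReturn V b, y = (i : ℤ) +ᵥ b := by
  have hlast : -(lastVisit V y : ℤ) +ᵥ y ∈ V := Nat.sInf_mem (exists_neg_natCast_vadd_mem hV hne y)
  refine ⟨_, hlast, lastVisit V y, ?_, (vadd_neg_vadd _ _).symm⟩
  by_contra! hle
  obtain ⟨hpos, hmem⟩ := nextReturn_mem hV hne (-(lastVisit V y : ℤ) +ᵥ y)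
  set n := nextReturn V (-(lastVisit V y : ℤ) +ᵥ y)
  refine Nat.notMem_of_lt_sInf (show lastVisit V y - n < lastVisit V y by omega) ?_
  rwa [mem_ofPred_eq, Nat.cast_sub hle, neg_sub, sub_eq_add_neg, add_vadd]

end Returns

section Towers

variable {X M : Type*} [AddAction ℤ X]

/-- The labeling of `X` that reads the word `c h 0, …, c h (h - 1)` upwards along the part of
height `h` of the Kakutani–Rokhlin tower over `V`, that is, along `b, 1 +ᵥ b, …, (h - 1) +ᵥ b` for
the points `b` of `V` whose first return to `V` takes the time `h`. -/
noncomputable def towerMap (V : Set X) (c : ℕ → ℕ → M) (x : X) : M :=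
  c (nextReturn V (-(lastVisit V x : ℤ) +ᵥ x)) (lastVisit V x)

variable {V : Set X} {c : ℕ → ℕ → M} {b : X}

theorem towerMap_natCast_vadd (hb : b ∈ V) {i : ℕ} (hi : i < nextReturn V b) :
    towerMap V c ((i : ℤ) +ᵥ b) = c (nextReturn V b) i := by
  rw [towerMap, lastVisit_natCast_vadd hb hi, neg_vadd_vadd]

variable [TopologicalSpace X] [ContinuousConstVAdd ℤ X] [CompactSpace X] [AddAction.IsMinimal ℤ X]

theorem continuous_towerMap [TopologicalSpace M] (hV : IsClopen V) (hne : V.Nonempty)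
    (c : ℕ → ℕ → M) : Continuous (towerMap V c) := by
  refine ((IsLocallyConstant.iff_eventually_eq _).2 fun y => ?_).continuous
  obtain ⟨b, hb, i, hi, rfl⟩ := exists_eq_natCast_vadd hV.isOpen hne y
  have hbase : IsOpen (V ∩ {x | nextReturn V x = nextReturn V b}) :=
    hV.isOpen.inter (isOpen_setOf_nextReturn_eq hV (nextReturn_mem hV.isOpen hne b).1)
  filter_upwards [(hbase.preimage (continuous_const_vadd (-(i : ℤ)))).mem_nhds
    (by simpa only [mem_preimage, neg_vadd_vadd] using ⟨hb, rfl⟩)] with z ⟨hzV, hz⟩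
  rw [← vadd_neg_vadd (i : ℤ) z, towerMap_natCast_vadd hzV (hi.trans_eq hz.symm), hz,
    towerMap_natCast_vadd hb hi]

variable {R : M → M → Prop} {S : Set M} {s : M}

theorem range_towerMap (hV : IsOpen V) (hne : V.Nonempty)
    (hc : ∀ b ∈ V, IsCoveringWalk R S s (nextReturn V b) (c (nextReturn V b))) :
    range (towerMap V c) = S := by
  refine Subset.antisymm (range_subset_iff.2 fun y => ?_) ?_
  · obtain ⟨b, hb, i, hi, rfl⟩ := exists_eq_natCast_vadd hV hne y
    rw [towerMap_natCast_vadd hb hi, ← (hc b hb).image_eq]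
    exact mem_image_of_mem _ hi
  · obtain ⟨b, hb⟩ := hne
    rw [← (hc b hb).image_eq]
    rintro _ ⟨i, hi, rfl⟩
    exact ⟨(i : ℤ) +ᵥ b, towerMap_natCast_vadd hb hi⟩

theorem isWalk_towerMap (hV : IsOpen V) (hne : V.Nonempty)
    (hc : ∀ b ∈ V, IsCoveringWalk R S s (nextReturn V b) (c (nextReturn V b))) :
    IsWalk R (towerMap V c) := fun y => by
  obtain ⟨b, hb, i, hi, rfl⟩ := exists_eq_natCast_vadd hV hne y
  have hstep := (hc b hb).step i hi
  have hnext : (1 : ℤ) +ᵥ (i : ℤ) +ᵥ b = ((i + 1 : ℕ) : ℤ) +ᵥ b := by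
    rw [vadd_vadd, add_comm, Nat.cast_add_one]
  rw [hnext, towerMap_natCast_vadd hb hi]
  rcases (Nat.succ_le_of_lt hi).lt_or_eq with hlt | htop
  · rwa [towerMap_natCast_vadd hb hlt]
  · have hmem := (nextReturn_mem hV hne b).2
    rw [← htop] at hmem
    have hpos := (hc _ hmem).pos
    have hzero := towerMap_natCast_vadd (c := c) hmem hpos
    rw [Nat.cast_zero, zero_vadd, (hc _ hmem).start_eq] at hzero
    have hend : c (nextReturn V b) (i + 1) = s := (congrArg _ htop).trans (hc b hb).end_eq
    rwa [hend, ← hzero] at hstep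

theorem exists_continuous_walk_of_returnTimes [TopologicalSpace M] (hV : IsClopen V)
    (hne : V.Nonempty) (hret : ∀ n ∈ returnTimes V, 0 < n → n ∈ coverLengths R S s) :
    ∃ g : X → M, Continuous g ∧ range g = S ∧ IsWalk R g := by
  have hwalk : ∀ n, ∃ c : ℕ → M, n ∈ coverLengths R S s → IsCoveringWalk R S s n c := fun n => by
    by_cases hn : n ∈ coverLengths R S s
    exacts [hn.imp fun _ hc _ => hc, ⟨fun _ => s, fun h => absurd h hn⟩]
  choose c hc using hwalk
  have hcover : ∀ b ∈ V, IsCoveringWalk R S s (nextReturn V b) (c (nextReturn V b)) :=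
    fun b hb => have hnext := nextReturn_mem hV.isOpen hne b
      hc _ (hret _ ⟨b, hb, hnext.2⟩ hnext.1)
  exact ⟨towerMap V c, continuous_towerMap hV hne c, range_towerMap hV.isOpen hne hcover,
    isWalk_towerMap hV.isOpen hne hcover⟩

end Towers

section Spectrum

variable {X : Type} [TopologicalSpace X] [AddAction ℤ X] [ContinuousConstVAdd ℤ X] [CompactSpace X]

theorem exists_isClopen_forall_returnTimes_dvd [T2Space X] [TotallyDisconnectedSpace X]
    [Nonempty X] (hfree : IsFreeAction X) {p : ℕ} (hp : p ∈ periodicSpectrum X) (N : ℕ) :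
    ∃ V : Set X, IsClopen V ∧ V.Nonempty ∧ ∀ n ∈ returnTimes V, 0 < n → N ≤ n ∧ p ∣ n := by
  obtain ⟨-, f, hf, hstep⟩ := mem_periodicSpectrum_iff.1 hp
  obtain ⟨x⟩ := ‹Nonempty X›
  obtain ⟨V, hVf, hV, hxV, hret⟩ := exists_isClopen_forall_returnTimes_ge (fun m => hfree m x)
    (((isOpen_discrete {f x}).preimage hf).mem_nhds rfl) N
  refine ⟨V, hV, ⟨x, hxV⟩, fun n hn hpos => ⟨hret n hn hpos, ?_⟩⟩
  obtain ⟨y, hy, hny⟩ := hn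
  have hfny : f ((n : ℤ) +ᵥ y) = f y := (hVf hny).trans (hVf hy).symm
  rw [map_vadd_of_map_one_vadd hstep, add_eq_left, Int.cast_natCast] at hfny
  exact (ZMod.natCast_eq_zero_iff _ _).1 hfny

variable [AddAction.IsMinimal ℤ X]

theorem mem_periodicSpectrum_of_forall_returnTimes_dvd {V : Set X} (hV : IsOpen V)
    (hne : V.Nonempty) {p : ℕ} (hp : 0 < p) (hret : ∀ n ∈ returnTimes V, p ∣ n) :
    p ∈ periodicSpectrum X := by
  choose n _ hn using exists_ge_natCast_vadd_mem hV hne 0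
  have hclass : ∀ {a b : ℕ} {x : X}, (a : ℤ) +ᵥ x ∈ V → (b : ℤ) +ᵥ x ∈ V →
      (a : ZMod p) = b := fun {a b x} ha hb => by
    wlog hab : a ≤ b generalizing a b
    · exact (this hb ha (le_of_not_ge hab)).symm
    refine (ZMod.natCast_eq_natCast_iff _ _ _).2
      ((Nat.modEq_iff_dvd' hab).2 (hret _ ⟨_, ha, ?_⟩))
    rwa [vadd_vadd, ← Nat.cast_add, Nat.sub_add_cancel hab]
  refine mem_periodicSpectrum_iff.2 ⟨hp, fun x => -(n x : ZMod p), ?_, fun x => ?_⟩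
  · refine ((IsLocallyConstant.iff_eventually_eq _).2 fun x => ?_).continuous
    filter_upwards [(hV.preimage (continuous_const_vadd (n x : ℤ))).mem_nhds (hn x)] with y hy
    rw [hclass (hn y) hy]
  · have hnext : ((n ((1 : ℤ) +ᵥ x) + 1 : ℕ) : ℤ) +ᵥ x ∈ V := by
      rw [Nat.cast_add_one, add_vadd]
      exact hn _
    dsimp only
    rw [← hclass hnext (hn x), Nat.cast_add_one]
    ring

variable {M : Type*} [TopologicalSpace M] [DiscreteTopology M] {R : M → M → Prop} {S : Set M}
  {s : M} {g : X → M}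

theorem IsWalk.exists_forall_ge_mem_coverLengths (hg : IsWalk R g) (hcont : Continuous g) :
    ∃ B : ℕ, ∀ n > B, ∀ x, g ((n : ℤ) +ᵥ x) = g x → n ∈ coverLengths R (range g) (g x) := by
  have hbound : ∀ t ∈ range g, ∃ B : ℕ, ∀ x, ∃ i ≤ B, g ((i : ℤ) +ᵥ x) = t := by
    rintro _ ⟨y, rfl⟩
    exact exists_forall_exists_le_natCast_vadd_mem ((isOpen_discrete {g y}).preimage hcont) ⟨y, rfl⟩
  choose! B hB using hbound
  obtain ⟨N, hN⟩ := ((isCompact_range hcont).finite_of_discrete.image B).bddAbove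
  refine ⟨N, fun n hn x hreturn =>
    hg.mem_coverLengths (Nat.zero_lt_of_lt hn) hreturn fun y => ?_⟩
  obtain ⟨i, hi, hiy⟩ := hB (g y) (mem_range_self y) x
  exact ⟨i, (hi.trans (hN (mem_image_of_mem B (mem_range_self y)))).trans_lt hn, hiy⟩

theorem IsWalk.setGcd_coverLengths_mem_periodicSpectrum (hg : IsWalk R g) (hcont : Continuous g)
    (x : X) : Nat.setGcd (coverLengths R (range g) (g x)) ∈ periodicSpectrum X := by
  obtain ⟨B, hB⟩ := hg.exists_forall_ge_mem_coverLengths hcont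
  have hV : IsOpen (g ⁻¹' {g x}) := (isOpen_discrete _).preimage hcont
  have hne : (g ⁻¹' {g x}).Nonempty := ⟨x, rfl⟩
  obtain ⟨m, hm, hmx⟩ := exists_ge_natCast_vadd_mem hV hne (B + 1) x
  refine mem_periodicSpectrum_of_forall_returnTimes_dvd hV hne
    (Nat.pos_of_dvd_of_pos (Nat.setGcd_dvd_of_mem (hB m hm x hmx)) (Nat.zero_lt_of_lt hm)) ?_
  rintro n ⟨y, hy : g y = g x, hny : g _ = g x⟩
  obtain ⟨m, hm, hmy : g _ = g x⟩ := exists_ge_natCast_vadd_mem hV hne (B + 1) ((n : ℤ) +ᵥ y)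
  have hmL := hB m hm _ (hmy.trans hny.symm)
  rw [vadd_vadd, ← Nat.cast_add] at hmy
  have hmnL := hB (m + n) (by omega) _ (hmy.trans hy.symm)
  rw [hny] at hmL
  rw [hy] at hmnL
  exact (Nat.dvd_add_right (Nat.setGcd_dvd_of_mem hmL)).1 (Nat.setGcd_dvd_of_mem hmnL)

/- A sufficiently long closed walk covers `S` exactly when `p`, the gcd of the lengths, divides its
length, so a walk read off a tower over a base with large return times divisible by `p` is
available; conversely `p` divides all return times to a state. -/
theorem exists_continuous_walk_iff [T2Space X] [TotallyDisconnectedSpace X]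
    (hfree : IsFreeAction X) [Nonempty X] (hs : s ∈ S) :
    (∃ g : X → M, Continuous g ∧ range g = S ∧ IsWalk R g) ↔
      Nat.setGcd (coverLengths R S s) ∈ periodicSpectrum X := by
  constructor
  · rintro ⟨g, hcont, rfl, hg⟩
    obtain ⟨x, rfl⟩ := hs
    exact hg.setGcd_coverLengths_mem_periodicSpectrum hcont x
  · intro hp
    obtain ⟨N, hN⟩ := Filter.eventually_atTop.1
      (eventually_mem_of_setGcd_dvd fun _ hm _ hn => add_mem_coverLengths hm hn)
    obtain ⟨V, hV, hne, hret⟩ := exists_isClopen_forall_returnTimes_dvd hfree hp N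
    exact exists_continuous_walk_of_returnTimes hV hne fun n hn hpos =>
      hN n (hret n hn hpos).1 (hret n hn hpos).2

end Spectrum

/-! ### The limit of the cyclic graphs -/

theorem IsFreeAction.isStableAction {X : Type} [TopologicalSpace X] [AddAction ℤ X]
    (hfree : IsFreeAction X) : IsStableAction X := fun m x hmx => by
  rw [hfree m x hmx]
  exact .of_forall fun y => zero_vadd ℤ y

theorem exists_continuous_conf_eq_iff_eventually_cyclicGraph {X : Type} [TopologicalSpace X]
    [CompactSpace X] [T2Space X] [TotallyDisconnectedSpace X] [Nonempty X] [AddAction ℤ X]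
    [ContinuousConstVAdd ℤ X] [AddAction.IsMinimal ℤ X] (hfree : IsFreeAction X) {ρ : ℕ → ℕ}
    (hρ : Filter.Tendsto ρ Filter.atTop Filter.atTop)
    (hspec : periodicSpectrum X = arithmeticSpectrum ρ) {Q : Type} [TopologicalSpace Q]
    [DiscreteTopology Q] (r : ℕ) (A : Set (LabeledClass Q)) :
    (∃ ψ : X → Q, Continuous ψ ∧ Conf r ψ = A) ↔
      ∀ᶠ k in Filter.atTop, ∃ φ : (cyclicGraph (ρ k)).Vert → Q, Conf r φ = A := by
  have hlarge : ∀ᶠ k in Filter.atTop, (∃ φ : (cyclicGraph (ρ k)).Vert → Q, Conf r φ = A) ↔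
      A ⊆ range (windowClass : Window r Q → _) ∧ ∃ g : (cyclicGraph (ρ k)).Vert → Window r Q,
        range g = windowClass ⁻¹' A ∧ IsWalk Follows g :=
    (hρ.eventually_gt_atTop (2 * r + 1)).mono fun k hk =>
      exists_conf_eq_iff (isFreeUpTo_cyclicGraph hk) A
  rw [exists_continuous_conf_eq_iff (fun x m _ => hfree m x) A, Filter.eventually_congr hlarge]
  rcases (windowClass ⁻¹' A : Set (Window r Q)).eq_empty_or_nonempty with hempty | ⟨s, hs⟩
  · have hnone : ∀ {V : Type} [Nonempty V] (g : V → Window r Q), range g ≠ windowClass ⁻¹' A :=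
      fun g => hempty ▸ (range_nonempty g).ne_empty
    have (k : ℕ) : Nonempty (cyclicGraph (ρ k)).Vert := inferInstanceAs (Nonempty (ZMod (ρ k)))
    simp only [hnone, false_and, and_false, exists_false, Filter.eventually_const]
  · rw [exists_continuous_walk_iff hfree hs, hspec,
      setGcd_mem_arithmeticSpectrum_iff (fun _ hm _ hn => add_mem_coverLengths hm hn) hρ,
      Filter.eventually_and, Filter.eventually_const]
    refine and_congr_right fun _ => Filter.eventually_congr ?_
    filter_upwards [hρ.eventually_gt_atTop 0] with k hk
    exact (exists_walk_cyclicGraph_iff hk hs).symm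

theorem isQualitativeLimit_of_periodicSpectrum_eq {X : Type} [TopologicalSpace X]
    [CompactSpace X] [T2Space X] [TotallyDisconnectedSpace X] [Nonempty X] [AddAction ℤ X]
    [ContinuousConstVAdd ℤ X] [AddAction.IsMinimal ℤ X] (hfree : IsFreeAction X) {ρ : ℕ → ℕ}
    (hρ : Filter.Tendsto ρ Filter.atTop Filter.atTop)
    (hconv : QualitativelyConvergent fun k => cyclicGraph (ρ k))
    (hspec : periodicSpectrum X = arithmeticSpectrum ρ) :
    IsQualitativeLimit (fun k => cyclicGraph (ρ k)) X :=
  ⟨hconv, hfree.isStableAction, fun _ _ _ _ r _ A _ =>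
    (exists_continuous_conf_eq_iff_eventually_cyclicGraph hfree hρ hspec r A).trans
      Filter.eventually_atTop⟩

/-! ### Orbit closures -/

section DenseOrbit

variable {G X : Type*} [TopologicalSpace X]

theorem isMinimal_of_dense_orbit [AddGroup G] [RegularSpace X] [AddAction G X]
    [ContinuousConstVAdd G X] {x : X} (hdense : Dense (AddAction.orbit G x))
    (hrec : ∀ U ∈ 𝓝 x, ∃ F : Set G, F.Finite ∧ ∀ g : G, ∃ a ∈ F, (a + g) +ᵥ x ∈ U) :
    AddAction.IsMinimal G X := by
  refine ⟨fun y => dense_iff_inter_open.2 fun U hU hne => ?_⟩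
  obtain ⟨_, hg, g, rfl⟩ := hdense.inter_open_nonempty U hU hne
  obtain ⟨C, ⟨hCx, hC⟩, hCU⟩ := (closed_nhds_basis x).mem_iff.1
    ((hU.preimage (continuous_const_vadd g)).mem_nhds hg)
  obtain ⟨F, hF, hreturn⟩ := hrec C hCx
  have hclosed : IsClosed (⋃ a ∈ F, (a +ᵥ ·) ⁻¹' C) :=
    hF.isClosed_biUnion fun a _ => hC.preimage (continuous_const_vadd a)
  have horbit : AddAction.orbit G x ⊆ ⋃ a ∈ F, (a +ᵥ ·) ⁻¹' C := by
    rintro _ ⟨b, rfl⟩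
    obtain ⟨a, ha, hab⟩ := hreturn b
    exact mem_iUnion₂.2 ⟨a, ha, by rwa [add_vadd] at hab⟩
  obtain ⟨a, -, ha⟩ := mem_iUnion₂.1 (closure_minimal horbit hclosed (hdense y))
  exact ⟨g +ᵥ a +ᵥ y, hCU ha, g + a, add_vadd g a y⟩

theorem vadd_eq_of_vadd_eq [AddCommMonoid G] [T2Space X] [AddAction G X] [ContinuousConstVAdd G X]
    [AddAction.IsMinimal G X] {g : G} {x : X} (hgx : g +ᵥ x = x) (y : X) : g +ᵥ y = y := by
  have horbit : EqOn (g +ᵥ ·) id (AddAction.orbit G x) := by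
    rintro _ ⟨a, rfl⟩
    exact (vadd_comm g a x).trans (congrArg _ hgx)
  exact congrFun ((continuous_const_vadd g).ext_on (AddAction.dense_orbit G x) continuous_id
    horbit) y

end DenseOrbit

theorem IsFreeAction.perfectSpace {X : Type} [TopologicalSpace X] [CompactSpace X] [AddAction ℤ X]
    [ContinuousConstVAdd ℤ X] [AddAction.IsMinimal ℤ X] (hfree : IsFreeAction X) :
    PerfectSpace X := by
  refine perfectSpace_iff_forall_not_isolated.2 fun x => ?_
  by_contra hx
  rw [Filter.not_neBot, ← isOpen_singleton_iff_punctured_nhds] at hx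
  obtain ⟨I, hI⟩ := isCompact_univ.exists_finite_cover_vadd ℤ hx (singleton_nonempty x)
  have hfinite : (univ : Set X).Finite :=
    (I.finite_toSet.biUnion fun m _ => (finite_singleton x).vadd_set).subset hI
  have : Finite X := finite_univ_iff.1 hfinite
  refine not_injective_infinite_finite (fun m : ℤ => m +ᵥ x) fun m n hmn => ?_
  have hfix : (-n + m) +ᵥ x = x := by rw [add_vadd, neg_vadd_eq_iff]; exact hmn
  exact (neg_add_eq_zero.1 (hfree _ x hfix)).symm

section Shift

open SymbolicDynamics.FullShift

variable {A : Type*} [TopologicalSpace A] (c : ℤ → A)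

/-- The closure of the orbit of the sequence `c` under the shift. -/
def orbitClosure : Set (ℤ → A) := closure (range fun m : ℤ => shift m c)

theorem shift_mem_orbitClosure (m : ℤ) {y : ℤ → A} (hy : y ∈ orbitClosure c) :
    shift m y ∈ orbitClosure c :=
  map_mem_closure (continuous_shift m) hy (by rintro _ ⟨n, rfl⟩; exact ⟨n + m, shift_add ..⟩)

instance : AddAction ℤ (orbitClosure c) where
  vadd m y := ⟨shift m y, shift_mem_orbitClosure c m y.2⟩
  zero_vadd y := Subtype.ext (shift_zero y.1)
  add_vadd m n y := Subtype.ext ((congrArg (shift · y.1) (add_comm m n)).trans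
    (shift_add n m y.1))

instance : ContinuousConstVAdd ℤ (orbitClosure c) :=
  ⟨fun m => ((continuous_shift m).comp continuous_subtype_val).subtype_mk _⟩

instance [CompactSpace A] : CompactSpace (orbitClosure c) :=
  isCompact_iff_compactSpace.1 (isClosed_closure (s := range fun m : ℤ => shift m c)).isCompact

theorem self_mem_orbitClosure : c ∈ orbitClosure c :=
  subset_closure ⟨0, shift_zero c⟩

/-- The sequence `c` as a point of its orbit closure. -/
def basePoint : orbitClosure c := ⟨c, self_mem_orbitClosure c⟩

instance : Nonempty (orbitClosure c) := ⟨basePoint c⟩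

theorem dense_orbit_basePoint : Dense (AddAction.orbit ℤ (basePoint c)) := fun y => by
  rw [closure_subtype]
  refine closure_mono ?_ y.2
  rintro _ ⟨m, rfl⟩
  exact ⟨m +ᵥ basePoint c, ⟨m, rfl⟩, rfl⟩

variable {c}

theorem tendsto_vadd_basePoint {l : Filter ℤ}
    (hc : ∀ n, Filter.Tendsto (fun m => c (m + n)) l (𝓝 (c n))) :
    Filter.Tendsto (· +ᵥ basePoint c) l (𝓝 (basePoint c)) :=
  tendsto_subtype_rng.2 (tendsto_pi_nhds.2 hc)

theorem isFreeAction_orbitClosure {B : Type} [TopologicalSpace B] [T2Space B] {c : ℤ → B}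
    [AddAction.IsMinimal ℤ (orbitClosure c)] (hc : ∀ m : ℤ, Function.Periodic c m → m = 0) :
    IsFreeAction (orbitClosure c) := fun m _ hmy => by
  refine hc m fun n => ?_
  rw [add_comm]
  exact congrFun (congrArg Subtype.val (vadd_eq_of_vadd_eq hmy (basePoint c))) n

end Shift

/-! ### A sequence with prescribed periodic spectrum -/

section Rotation

variable {α : ℝ}

theorem exists_fract_mem_Ioo (hα : Irrational α) {w : ℤ} (hw : w ≠ 0) (t : ℝ) {u v : ℝ}
    (hu : 0 ≤ u) (huv : u < v) (hv : v ≤ 1) :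
    ∃ m : ℤ, Int.fract (t + (m * w : ℤ) * α) ∈ Ioo u v := by
  have hdense : Dense (AddSubgroup.closure {w * α, 1} : Set ℝ) :=
    dense_addSubgroupClosure_pair_iff.2 (by simpa only [div_one] using hα.intCast_mul hw)
  obtain ⟨y, hy, hyG⟩ := hdense.exists_mem_open (isOpen_Ioo (a := u - t) (b := v - t))
    (nonempty_Ioo.2 (by linarith))
  obtain ⟨m, z, rfl⟩ := AddSubgroup.mem_closure_pair.1 hy
  simp only [zsmul_eq_mul, mul_one, mem_Ioo] at hyG
  refine ⟨m, ?_⟩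
  have hfract : Int.fract (t + (m * w : ℤ) * α) = t + m * (w * α) + z :=
    Int.fract_eq_iff.2 ⟨by linarith, by linarith, -z, by push_cast; ring⟩
  rw [hfract]
  constructor <;> linarith

/- Multiples of `w` rotate the circle by a small `δ > 0` after a suitable time `a`, so every orbit
enters `[0, ε)` along such steps, and at most `1 / δ` of them are needed. -/
theorem exists_forall_exists_fract_lt (hα : Irrational α) {w : ℕ} (hw : 0 < w) {ε : ℝ}
    (hε : 0 < ε) :
    ∃ N : ℤ, ∀ k : ℤ, ∃ f ∈ Icc (-N) N, (w : ℤ) ∣ f + k ∧ Int.fract ((f + k : ℤ) * α) < ε := by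
  obtain ⟨a, hδ⟩ := exists_fract_mem_Ioo hα (w := w) (by exact_mod_cast hw.ne') 0 le_rfl
    (lt_min hε one_pos) (min_le_right ε 1)
  rw [zero_add] at hδ
  set δ := Int.fract ((a * w : ℤ) * α) with hδ_def
  refine ⟨w + ⌈1 / δ⌉ * |a * w|, fun k => ?_⟩
  set i := -k % w
  have hi0 : 0 ≤ i := Int.emod_nonneg _ (by exact_mod_cast hw.ne')
  have hiw : i < w := Int.emod_lt_of_pos _ (by exact_mod_cast hw)
  have hik : (w : ℤ) ∣ i + k := by
    rw [← sub_neg_eq_add]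
    exact Int.dvd_emod_sub_self
  set t := Int.fract ((i + k : ℤ) * α)
  set j := ⌈(1 - t) / δ⌉
  have ht0 : 0 ≤ t := Int.fract_nonneg _
  have ht1 : t < 1 := Int.fract_lt_one _
  have hj0 : 0 ≤ j := Int.ceil_nonneg (div_nonneg (by linarith) hδ.1.le)
  have hjδ : j ≤ ⌈1 / δ⌉ :=
    Int.ceil_le_ceil (div_le_div_of_nonneg_right (by linarith) hδ.1.le)
  have hstep : |j * (a * w)| ≤ ⌈1 / δ⌉ * |a * w| := by
    rw [abs_mul, abs_of_nonneg hj0]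
    gcongr
  refine ⟨i + j * (a * w), ?_, ?_, ?_⟩
  · rw [mem_Icc, ← abs_le]
    exact (abs_add_le _ _).trans (add_le_add (by rw [abs_of_nonneg hi0]; exact hiw.le) hstep)
  · rw [add_right_comm]
    exact dvd_add hik ((dvd_mul_left _ _).mul_left _)
  · have hlower : 1 ≤ t + j * δ := by
      linarith [(div_le_iff₀ hδ.1).1 (Int.le_ceil ((1 - t) / δ))]
    have hupper : t + j * δ < 1 + δ := by
      have := mul_lt_mul_of_pos_right (Int.ceil_lt_add_one ((1 - t) / δ)) hδ.1
      rw [add_mul, div_mul_cancel₀ _ hδ.1.ne'] at this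
      linarith
    have hfract : Int.fract ((i + j * (a * w) + k : ℤ) * α) = t + j * δ - 1 := by
      refine Int.fract_eq_iff.2 ⟨by linarith, by linarith [lt_min_iff.1 hδ.2],
        ⌊(i + k : ℤ) * α⌋ + j * ⌊(a * w : ℤ) * α⌋ + 1, ?_⟩
      simp only [t, hδ_def, Int.fract]
      push_cast
      ring
    rw [hfract]
    linarith [lt_min_iff.1 hδ.2]

end Rotation

section SpectrumSequence

open Filter

variable {W : Set ℕ} {α : ℝ}

/-- The filter of times at which `n ↦ (n * α, n, n, …)` is close to `0` in the product of the
circle `ℝ / ℤ` and the groups `ℤ / w`, `w ∈ W`; the circle is approached from above only, since the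
coding of the circle by half-open arcs is continuous only from that side. -/
noncomputable def returnFilter (W : Set ℕ) (α : ℝ) : Filter ℤ :=
  (⨅ w ∈ W, 𝓟 {n : ℤ | (w : ℤ) ∣ n}) ⊓ comap (fun n : ℤ => Int.fract (n * α)) (𝓝 0)

theorem eventually_dvd_returnFilter {w : ℕ} (hw : w ∈ W) :
    ∀ᶠ n : ℤ in returnFilter W α, (w : ℤ) ∣ n :=
  mem_inf_of_left (mem_iInf_of_mem w (mem_iInf_of_mem hw (mem_principal_self _)))

theorem tendsto_fract_returnFilter :
    Tendsto (fun n : ℤ => Int.fract (n * α)) (returnFilter W α) (𝓝 0) :=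
  tendsto_comap.mono_left inf_le_right

theorem exists_of_eventually_returnFilter (hne : W.Nonempty)
    (hlcm : ∀ m ∈ W, ∀ n ∈ W, m.lcm n ∈ W) {P : ℤ → Prop}
    (hP : ∀ᶠ n in returnFilter W α, P n) :
    ∃ w ∈ W, ∃ ε > 0, ∀ n : ℤ, (w : ℤ) ∣ n → Int.fract (n * α) < ε → P n := by
  have hdirected : DirectedOn ((fun w : ℕ => {n : ℤ | (w : ℤ) ∣ n}) ⁻¹'o (· ≥ ·)) W :=
    fun m hm n hn => ⟨m.lcm n, hlcm m hm n hn,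
      fun _ h => (Int.natCast_dvd_natCast.2 (Nat.dvd_lcm_left m n)).trans h,
      fun _ h => (Int.natCast_dvd_natCast.2 (Nat.dvd_lcm_right m n)).trans h⟩
  obtain ⟨⟨w, ε⟩, ⟨hw, hε⟩, hwε⟩ := ((hasBasis_biInf_principal hdirected hne).inf
    (Metric.nhds_basis_ball.comap fun n : ℤ => Int.fract (n * α))).eventually_iff.1 hP
  refine ⟨w, hw, ε, hε, fun n hn hnε => hwε ⟨hn, ?_⟩⟩
  rwa [mem_preimage, Metric.mem_ball, Real.dist_0_eq_abs, abs_of_nonneg (Int.fract_nonneg _)]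

/-- The coding of the orbit `n ↦ (n * α, n, n, …)` in the product of the circle `ℝ / ℤ` and the
groups `ℤ / w`, `w ∈ W`; of the circle coordinate only the half in which it lies is recorded. -/
noncomputable def spectrumSequence (W : Set ℕ) (α : ℝ) : ℤ → Bool × ∀ w : W, ZMod w :=
  fun n => (decide (Int.fract (n * α) < 1 / 2), fun _ => n)

theorem tendsto_spectrumSequence (n : ℤ) :
    Tendsto (fun m => spectrumSequence W α (m + n)) (returnFilter W α)
      (𝓝 (spectrumSequence W α n)) := by
  refine Tendsto.prodMk_nhds ?_ (tendsto_pi_nhds.2 fun w => ?_)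
  · set t := Int.fract (n * α)
    have ht0 : 0 ≤ t := Int.fract_nonneg _
    have ht1 : t < 1 := Int.fract_lt_one _
    obtain ⟨ε, hε, hεt⟩ : ∃ ε > 0, t + ε ≤ 1 ∧ (t < 1 / 2 → t + ε ≤ 1 / 2) := by
      rcases lt_or_ge t (1 / 2) with ht | ht
      · exact ⟨1 / 2 - t, by linarith, by linarith, fun _ => by linarith⟩
      · exact ⟨1 - t, by linarith, by linarith, fun h => absurd h ht.not_gt⟩
    refine tendsto_nhds_of_eventually_eq ?_
    filter_upwards [tendsto_fract_returnFilter.eventually (gt_mem_nhds hε)] with m hm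
    have hm0 : 0 ≤ Int.fract (m * α) := Int.fract_nonneg _
    have hfract : Int.fract ((m + n : ℤ) * α) = Int.fract (m * α) + t := by
      refine Int.fract_eq_iff.2 ⟨by linarith, by linarith, ⌊m * α⌋ + ⌊n * α⌋, ?_⟩
      simp only [t, Int.fract]
      push_cast
      ring
    rw [hfract, decide_eq_decide]
    exact ⟨fun h => by linarith, fun h => by linarith [hεt.2 h]⟩
  · refine tendsto_nhds_of_eventually_eq ?_
    filter_upwards [eventually_dvd_returnFilter w.2] with m hm
    rw [Int.cast_add, (ZMod.intCast_zmod_eq_zero_iff_dvd m w).2 hm, zero_add]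

theorem isMinimal_orbitClosure_spectrumSequence (hα : Irrational α) (hpos : ∀ w ∈ W, 0 < w)
    (hne : W.Nonempty) (hlcm : ∀ m ∈ W, ∀ n ∈ W, m.lcm n ∈ W) :
    AddAction.IsMinimal ℤ (orbitClosure (spectrumSequence W α)) := by
  refine isMinimal_of_dense_orbit (dense_orbit_basePoint _) fun U hU => ?_
  obtain ⟨w, hw, ε, hε, hU⟩ := exists_of_eventually_returnFilter hne hlcm
    ((tendsto_vadd_basePoint tendsto_spectrumSequence).eventually hU)
  obtain ⟨N, hN⟩ := exists_forall_exists_fract_lt hα (hpos w hw) hε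
  refine ⟨Icc (-N) N, finite_Icc _ _, fun k => ?_⟩
  obtain ⟨f, hf, hdvd, hfract⟩ := hN k
  exact ⟨f, hf, hU _ hdvd hfract⟩

theorem eq_zero_of_periodic_spectrumSequence (hα : Irrational α) {m : ℤ}
    (hm : Function.Periodic (spectrumSequence W α) m) : m = 0 := by
  by_contra hm0
  obtain ⟨k, hk⟩ := exists_fract_mem_Ioo hα hm0 0 (u := 1 / 2) (by norm_num) (by norm_num) le_rfl
  rw [zero_add] at hk
  have hbool := decide_eq_decide.1 (congrArg Prod.fst (hm.int_mul_eq k))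
  rw [Int.cast_zero, zero_mul, Int.fract_zero] at hbool
  exact hk.1.not_gt (hbool.2 (by norm_num))

theorem exists_dvd_of_mem_periodicSpectrum (hα : Irrational α) (hpos : ∀ w ∈ W, 0 < w)
    (hne : W.Nonempty) (hlcm : ∀ m ∈ W, ∀ n ∈ W, m.lcm n ∈ W) {X : Type} [TopologicalSpace X]
    [AddAction ℤ X] [ContinuousConstVAdd ℤ X] {x : X}
    (hx : Tendsto (· +ᵥ x) (returnFilter W α) (𝓝 x)) {n : ℕ} (hn : n ∈ periodicSpectrum X) :
    ∃ w ∈ W, n ∣ w := by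
  obtain ⟨hn0, f, hf, hf1⟩ := mem_periodicSpectrum_iff.1 hn
  obtain ⟨w, hw, ε, hε, hreturn⟩ := exists_of_eventually_returnFilter hne hlcm
    (((hf.tendsto x).comp hx).eventually (mem_nhds_discrete.2 (mem_singleton (f x))))
  have hdvd (m : ℤ) (hwm : (w : ℤ) ∣ m) (hm : Int.fract (m * α) < ε) : (n : ℤ) ∣ m := by
    have hfm : f (m +ᵥ x) = f x := hreturn m hwm hm
    rw [map_vadd_of_map_one_vadd hf1, add_eq_left] at hfm
    exact (ZMod.intCast_zmod_eq_zero_iff_dvd m n).1 hfm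
  have hwn : (w * n : ℤ) ≠ 0 := by exact_mod_cast (Nat.mul_pos (hpos w hw) hn0).ne'
  obtain ⟨m, hm⟩ := exists_fract_mem_Ioo hα hwn (w * α) le_rfl (lt_min hε one_pos)
    (min_le_right ε 1)
  have hndvd := hdvd (w + m * (w * n)) (dvd_add dvd_rfl ((dvd_mul_right _ _).mul_left _)) <| by
    refine lt_of_eq_of_lt ?_ (hm.2.trans_le (min_le_left ε 1))
    push_cast
    rw [add_mul]
  refine ⟨w, hw, Int.natCast_dvd_natCast.1 ?_⟩
  exact (dvd_add_left ((dvd_mul_left _ _).mul_left _)).1 hndvd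

theorem mem_periodicSpectrum_orbitClosure_spectrumSequence {w : ℕ} (hw : w ∈ W) (hw0 : 0 < w) :
    w ∈ periodicSpectrum (orbitClosure (spectrumSequence W α)) := by
  let f (y : orbitClosure (spectrumSequence W α)) : ZMod w := (y.1 0).2 ⟨w, hw⟩
  have hf : Continuous f := (continuous_apply _).comp
    (continuous_snd.comp ((continuous_apply 0).comp continuous_subtype_val))
  refine mem_periodicSpectrum_iff.2 ⟨hw0, f, hf, congrFun ?_⟩
  refine (hf.comp (continuous_const_vadd 1)).ext_on (dense_orbit_basePoint _)
    (hf.add continuous_const) ?_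
  rintro _ ⟨m, rfl⟩
  change ((m + (1 + 0) : ℤ) : ZMod w) = ((m + 0 : ℤ) : ZMod w) + 1
  push_cast
  ring

theorem periodicSpectrum_orbitClosure_spectrumSequence (hα : Irrational α) (hW : DivisionClosed W)
    (hne : W.Nonempty) (hlcm : ∀ m ∈ W, ∀ n ∈ W, m.lcm n ∈ W) :
    periodicSpectrum (orbitClosure (spectrumSequence W α)) = W := by
  ext n
  refine ⟨fun hn => ?_, fun hn => mem_periodicSpectrum_orbitClosure_spectrumSequence hn (hW.1 n hn)⟩
  obtain ⟨w, hw, hnw⟩ := exists_dvd_of_mem_periodicSpectrum hα hW.1 hne hlcm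
    (tendsto_vadd_basePoint tendsto_spectrumSequence) hn
  exact hW.2 w hw n hnw

end SpectrumSequence

section Transport

variable {X Y : Type} [TopologicalSpace X] [TopologicalSpace Y] [AddAction ℤ X] [AddAction ℤ Y]
  [ContinuousConstVAdd ℤ X] [ContinuousConstVAdd ℤ Y]

theorem periodicSpectrum_subset_of_continuous {f : X → Y} (hf : Continuous f)
    (hfadd : ∀ x, f ((1 : ℤ) +ᵥ x) = (1 : ℤ) +ᵥ f x) :
    periodicSpectrum Y ⊆ periodicSpectrum X := fun n hn => by
  obtain ⟨hn0, g, hg, hg1⟩ := mem_periodicSpectrum_iff.1 hn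
  exact mem_periodicSpectrum_iff.2 ⟨hn0, g ∘ f, hg.comp hf, fun x =>
    (congrArg g (hfadd x)).trans (hg1 (f x))⟩

end Transport

theorem exists_free_minimal_action_cantor {W : Set ℕ} (hW : DivisionClosed W) (hne : W.Nonempty)
    (hlcm : ∀ m ∈ W, ∀ n ∈ W, m.lcm n ∈ W) :
    ∃ (_ : AddAction ℤ Cantor) (_ : ContinuousConstVAdd ℤ Cantor),
      IsFreeAction Cantor ∧ AddAction.IsMinimal ℤ Cantor ∧ periodicSpectrum Cantor = W := by
  have (w : W) : NeZero (w : ℕ) := ⟨(hW.1 w w.2).ne'⟩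
  set c := spectrumSequence W √2
  have : AddAction.IsMinimal ℤ (orbitClosure c) :=
    isMinimal_orbitClosure_spectrumSequence irrational_sqrt_two hW.1 hne hlcm
  have hfree : IsFreeAction (orbitClosure c) := isFreeAction_orbitClosure fun _ =>
    eq_zero_of_periodic_spectrumSequence irrational_sqrt_two
  have := hfree.perfectSpace
  obtain ⟨e⟩ := nonempty_homeomorph_cantor (orbitClosure c)
  let _ : AddAction ℤ Cantor := e.symm.toEquiv.addAction ℤ
  have he (m : ℤ) (y : orbitClosure c) : e (m +ᵥ y) = m +ᵥ e y :=
    congrArg (fun z => e (m +ᵥ z)) (e.symm_apply_apply y).symm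
  have hsymm (m : ℤ) (z : Cantor) : e.symm (m +ᵥ z) = m +ᵥ e.symm z := e.symm_apply_apply _
  have : ContinuousConstVAdd ℤ Cantor :=
    ⟨fun m => e.continuous.comp ((continuous_const_vadd m).comp e.symm.continuous)⟩
  refine ⟨‹_›, this, fun m z hmz => hfree m (e.symm z) (by rw [← hsymm, hmz]), ⟨fun z => ?_⟩, ?_⟩
  · refine (e.surjective.denseRange.dense_image e.continuous
      (AddAction.dense_orbit ℤ (e.symm z))).mono ?_
    rintro _ ⟨_, ⟨m, rfl⟩, rfl⟩
    exact ⟨m, rfl⟩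
  · rw [← periodicSpectrum_orbitClosure_spectrumSequence irrational_sqrt_two hW hne hlcm]
    exact (periodicSpectrum_subset_of_continuous e.continuous (he 1)).antisymm
      (periodicSpectrum_subset_of_continuous e.symm.continuous (hsymm 1))

/-! ### The arithmetic spectrum -/

section ArithmeticSpectrum

open Filter

variable {ρ : ℕ → ℕ}

theorem divisionClosed_arithmeticSpectrum : DivisionClosed (arithmeticSpectrum ρ) :=
  ⟨fun _ hm => hm.1, fun _ hm _ hdvd =>
    ⟨Nat.pos_of_dvd_of_pos hdvd hm.1, hm.2.mono fun _ => hdvd.trans⟩⟩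

theorem one_mem_arithmeticSpectrum : 1 ∈ arithmeticSpectrum ρ :=
  ⟨one_pos, Eventually.of_forall fun _ => one_dvd _⟩

theorem lcm_mem_arithmeticSpectrum {m n : ℕ} (hm : m ∈ arithmeticSpectrum ρ)
    (hn : n ∈ arithmeticSpectrum ρ) : m.lcm n ∈ arithmeticSpectrum ρ :=
  ⟨Nat.lcm_pos hm.1 hn.1, (hm.2.and hn.2).mono fun _ h => Nat.lcm_dvd h.1 h.2⟩

end ArithmeticSpectrum

end QualLimit

open QualLimit in
theorem mainTheorem11_general {ρ : ℕ → ℕ} (hρ : Filter.Tendsto ρ Filter.atTop Filter.atTop)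
    (hconv : QualitativelyConvergent fun k => cyclicGraph (ρ k)) :
    (∃ (_ : AddAction ℤ Cantor) (_ : ContinuousConstVAdd ℤ Cantor), IsFreeAction Cantor ∧
      AddAction.IsMinimal ℤ Cantor ∧ periodicSpectrum Cantor = arithmeticSpectrum ρ) ∧
    ∀ (X : Type) [TopologicalSpace X] [CompactSpace X] [T2Space X] [TotallyDisconnectedSpace X]
      [Nonempty X] [AddAction ℤ X] [ContinuousConstVAdd ℤ X] [AddAction.IsMinimal ℤ X],
      IsFreeAction X → periodicSpectrum X = arithmeticSpectrum ρ →
      IsQualitativeLimit (fun k => cyclicGraph (ρ k)) X :=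
  ⟨exists_free_minimal_action_cantor divisionClosed_arithmeticSpectrum
    ⟨1, one_mem_arithmeticSpectrum⟩ fun _ hm _ hn => lcm_mem_arithmeticSpectrum hm hn,
    fun _ => fun hfree => isQualitativeLimit_of_periodicSpectrum_eq hfree hρ hconv⟩

theorem mainTheorem11 (W : Set ℕ) (hW : QualLimit.DivisionClosed W)
    (ρ : ℕ → ℕ) (hpos : ∀ k, 0 < ρ k) (hmono : StrictMono ρ)
    (hconv : QualLimit.QualitativelyConvergent fun k => QualLimit.cyclicGraph (ρ k))
    (hAr : QualLimit.arithmeticSpectrum ρ = W) :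
    (∃ (_ : AddAction ℤ QualLimit.Cantor) (_ : ContinuousConstVAdd ℤ QualLimit.Cantor),
      QualLimit.IsFreeAction QualLimit.Cantor ∧ AddAction.IsMinimal ℤ QualLimit.Cantor ∧
      QualLimit.periodicSpectrum QualLimit.Cantor = W) ∧
    ∀ (_ : AddAction ℤ QualLimit.Cantor) (_ : ContinuousConstVAdd ℤ QualLimit.Cantor),
      QualLimit.IsFreeAction QualLimit.Cantor → AddAction.IsMinimal ℤ QualLimit.Cantor →
      QualLimit.periodicSpectrum QualLimit.Cantor = W →
      QualLimit.IsQualitativeLimit (fun k => QualLimit.cyclicGraph (ρ k)) QualLimit.Cantor := by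
  subst hAr
  have hgeneral := mainTheorem11_general hmono.tendsto_atTop hconv
  exact ⟨hgeneral.1, fun _ _ hfree _ => hgeneral.2 QualLimit.Cantor hfree⟩
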